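/- Let $n\ge 0$ and let $\Phi$ be the root system of type $\mathbb{A}_n$ with simple roots $\alpha_1,\dots,\alpha_n$, positive roots $\alpha_i+\alpha_{i+1}+\cdots+\alpha_j$ ($1\le i\le j\le n$) and simple reflections $s_1,\dots,s_n$. Let $c=s_{\pi(1)}\cdots s_{\pi(n)}$ be any Coxeter element, $\pi$ a permutation of $\{1,\dots,n\}$. On the set $\Phi_{\ge -1}$ of almost positive roots (positive or negative simple roots), let $\sigma_k$ be the involution that fixes $-\alpha_j$ for $j\ne k$ and acts as $s_k$ otherwise, and put $\tau_c=\sigma_{\pi(1)}\circ\cdots\circ\sigma_{\pi(n)}$. Compatibility is the $\tau_c$-invariant relation on $\Phi_{\ge -1}$ such that $-\alpha_i$ is compatible with $\beta$ if and only if the coefficient of $\alpha_i$ in $\beta$ is at most $0$. The cluster complex (dual associahedron) $C$ of type $\mathbb{A}_n$ has as faces the sets of pairwise compatible almost positive roots; let $T=\{-\alpha_1,\dots,-\alpha_n\}$ be its distinguished facet. Let $F_{i,j}$ be the number of faces of $C$ with $i$ elements outside $T$ and $j$ elements in $T$, let $F(x,y)=\sum_{0\le i,j\le n}F_{i,j}x^iy^j$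 be the $F$-triangle and $$H(x,y)=(1-x)^n\,F\!\left(\frac{x}{1-x},\frac{xy}{1-x}\right)$$ the $H$-triangle. Then there is a unique family of integers $(\gamma_{i,j})_{i,j\ge0}$, the $\Gamma$-triangle of $(C,T)$, with $\gamma_{i,j}=0$ for $j+2i>n$ and $$H(x,y)=(1+x)^n\sum_{i,j}\gamma_{i,j}\left(\frac{x}{(1+x)^2}\right)^i\left(\frac{1+xy}{1+x}\right)^j .$$ For all $k,\ell\ge 0$ with $\ell+2k\le n$, the coefficient of $x^ky^\ell$ in $\Gamma(x,y)=\sum_{i,j}\gamma_{i,j}x^iy^j$ is $$\gamma_{k,\ell}=\frac{\ell+1}{n-k+1}\binom{n}{k}\binom{n-k-\ell-1}{k-1},$$ where for $k=0$ the last binomial coefficient $\binom{n-\ell-1}{-1}$ is read as $1$ if $\ell=n$ and as $0$ if $\ell<n$; that is, $\gamma_{0,n}=1$ and $\gamma_{0,\ell}=0$ for $\ell<n$. -/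

import Mathlib

noncomputable section

/-! ### Finite simplicial complexes, `F`-, `H`- and `Γ`-triangles -/

/-- A finite simplicial complex: a finite collection of finite sets closed under taking subsets
(the empty set is a face as soon as there is a face). -/
structure FinComplex (V : Type*) where
  faces : Finset (Finset V)
  down_closed : ∀ F ∈ faces, ∀ G, G ⊆ F → G ∈ faces

namespace FinComplex

variable {V : Type*} [DecidableEq V]

/-- The number `F_{i,j}` of faces made of `i` elements outside `T` and `j` elements in `T`. -/
def fNumber (C : FinComplex V) (T : Finset V) (i j : ℕ) : ℕ :=
  (C.faces.filter fun F => (F \ T).card = i ∧ (F ∩ T).card = j).card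

/-- The `F`-triangle `∑_{0 ≤ i, j ≤ d} F_{i,j} x^i y^j` of the pair `(C, T)`, where
`d = |T|`. The variables `x`, `y` are `X 0`, `X 1`. -/
def fTriangle (C : FinComplex V) (T : Finset V) : MvPolynomial (Fin 2) ℤ :=
  ∑ i ∈ Finset.range (T.card + 1), ∑ j ∈ Finset.range (T.card + 1),
    MvPolynomial.C (C.fNumber T i j : ℤ) * MvPolynomial.X 0 ^ i * MvPolynomial.X 1 ^ j

end FinComplex

/-- The field `ℚ(x, y)` of rational functions in two variables. -/
abbrev RatXY : Type := FractionRing (MvPolynomial (Fin 2) ℤ)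

/-- The variable `x` in `ℚ(x, y)`. -/
def ratX : RatXY := algebraMap (MvPolynomial (Fin 2) ℤ) RatXY (MvPolynomial.X 0)

/-- The variable `y` in `ℚ(x, y)`. -/
def ratY : RatXY := algebraMap (MvPolynomial (Fin 2) ℤ) RatXY (MvPolynomial.X 1)

namespace FinComplex

variable {V : Type*} [DecidableEq V]

/-- The `H`-triangle `H(x, y) = (1 - x)^d F(x / (1 - x), x y / (1 - x))`, with `d = |T|`. -/
def hTriangle (C : FinComplex V) (T : Finset V) : RatXY :=
  (1 - ratX) ^ T.card *
    MvPolynomial.aeval ![ratX / (1 - ratX), ratX * ratY / (1 - ratX)] (C.fTriangle T)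

/-- `γ` is the `Γ`-triangle of `(C, T)`: it is supported on the triangle `j ≤ d - 2 i`, and
`H(x, y) = (1 + x)^d ∑_{i, j} γ_{i,j} (x / (1 + x)^2)^i ((1 + x y) / (1 + x))^j`,
with `d = |T|`. -/
def IsGammaTriangle (C : FinComplex V) (T : Finset V) (γ : ℕ → ℕ → ℤ) : Prop :=
  (∀ i j, T.card < j + 2 * i → γ i j = 0) ∧
  C.hTriangle T = (1 + ratX) ^ T.card *
    ∑ i ∈ Finset.range (T.card + 1), ∑ j ∈ Finset.range (T.card + 1),
      (γ i j : RatXY) * (ratX / (1 + ratX) ^ 2) ^ i * ((1 + ratX * ratY) / (1 + ratX)) ^ j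

end FinComplex

/-! ### The cluster complex of type `A_n`

Elements of the root lattice are written in the basis of simple roots `α_0, …, α_{n-1}`, as
functions `Fin n → ℤ`. -/

namespace TypeA

variable {n : ℕ}

/-- The simple root `α_i`. -/
def simpleRoot (i : Fin n) : Fin n → ℤ := Pi.single i 1

/-- The simple reflection `s_k(v) = v - ⟨v, α_k^∨⟩ α_k`. -/
def simpleReflection (k : Fin n) (v : Fin n → ℤ) : Fin n → ℤ :=
  v - (∑ j, v j * CartanMatrix.A n j k) • simpleRoot k

/-- The negative simple roots `-α_i`. -/
def negSimpleRoots (n : ℕ) : Finset (Fin n → ℤ) :=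
  Finset.univ.image fun i : Fin n => -simpleRoot i

/-- The positive roots of type `A_n`: the sums `α_i + α_{i+1} + ⋯ + α_j` for `i ≤ j`. -/
def positiveRoots (n : ℕ) : Finset (Fin n → ℤ) :=
  ((Finset.univ : Finset (Fin n × Fin n)).filter fun p => p.1 ≤ p.2).image
    fun p => ∑ m ∈ Finset.Icc p.1 p.2, simpleRoot m

/-- The almost positive roots. -/
def almostPositiveRoots (n : ℕ) : Finset (Fin n → ℤ) :=
  negSimpleRoots n ∪ positiveRoots n

/-- The involution `σ_k` of the set of almost positive roots: it fixes `-α_j` for `j ≠ k` and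
acts as the simple reflection `s_k` on the other almost positive roots. -/
def sigma (k : Fin n) (v : Fin n → ℤ) : Fin n → ℤ :=
  if v ∈ negSimpleRoots n ∧ v ≠ -simpleRoot k then v else simpleReflection k v

/-- A Coxeter element `c = s_{π 0} s_{π 1} ⋯ s_{π (n-1)}` is given by an ordering `π` of the simple
reflections. This is the associated map `τ_c = σ_{π 0} ∘ σ_{π 1} ∘ ⋯ ∘ σ_{π (n-1)}` on almost
positive roots. -/
def tau (π : Equiv.Perm (Fin n)) : (Fin n → ℤ) → (Fin n → ℤ) :=
  (List.ofFn fun k => sigma (π k)).foldr (· ∘ ·) id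

/-- Compatibility of almost positive roots with respect to the Coxeter element `c`: it is the
`τ_c`-invariant relation for which `-α_i` is compatible with `β` if and only if the coefficient of
`α_i` in `β` is not positive (that is, `β` is a negative simple root, or a positive root whose
support does not contain `α_i`). Every almost positive root is moved to some `-α_i` by a power of
`τ_c`, so these two conditions determine the relation. -/
def Compatible (π : Equiv.Perm (Fin n)) (α β : Fin n → ℤ) : Prop :=
  ∃ (m : ℕ) (i : Fin n), (tau π)^[m] α = -simpleRoot i ∧ (tau π)^[m] β i ≤ 0

open Classical in
/-- The cluster complex of type `A_n` for the Coxeter element given by `π`: its faces are the sets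
of pairwise compatible almost positive roots. -/
def clusterComplex (π : Equiv.Perm (Fin n)) : FinComplex (Fin n → ℤ) where
  faces := (almostPositiveRoots n).powerset.filter fun F =>
    ∀ α ∈ F, ∀ β ∈ F, α ≠ β → Compatible π α β
  down_closed := by
    intro F hF G hG
    rw [Finset.mem_filter, Finset.mem_powerset] at hF ⊢
    exact ⟨hG.trans hF.1, fun α hα β hβ => hF.2 α (hG hα) β (hG hβ)⟩

end TypeA

end

/-!
A Coxeter element determines a zigzag triangulation of the convex `(n + 3)`-gon. Send a diagonal to
its vector of crossing numbers with the `n` diagonals of this triangulation, a diagonal being said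
to cross itself `-1` times. Composing the `σ_k` moves the triangulation one flip at a time until it
has turned by one step, so that `τ_c` becomes the rotation of the polygon, compatible means not
crossing, and `T` becomes the triangulation itself: the `F`-triangle counts the dissections of the
polygon by their diagonals outside and inside the triangulation.

Give the weight `v` to the diagonals of the triangulation and `u` to the others. Replacing the
weights `v` by `u` one at a time changes the sum over dissections by products of sums over smaller
polygons, which do not remember the zigzag. Hence all zigzags have the same generating function
`G_v`, and it satisfies `G_v = g + (v - u) t g G_v` with `g = G_u`. The fan, for which `v = 0`
amounts to forgetting a vertex, gives `G_0 = 1 + (1 + u) t g` and thus determines `g`.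
With `W = t G_{-1-u}`, these equations become
`W = t (1 + u (1 + u) W ^ 2 / (1 - (1 + 2 u) W))` and `t G_v = W / (1 - (1 + u + v) W)`,
and Lagrange inversion gives the coefficients of `G_v`. At `u = x / (1 - x)` and
`v = x y / (1 - x)`, the quantities `u (1 + u)`, `1 + 2 u` and `1 + u + v` are `x / (1 - x) ^ 2`,
`(1 + x) / (1 - x)` and `(1 + x y) / (1 - x)`, and the `Γ`-triangle can be read off.
-/

noncomputable section

section IndependenceSum

open Finset

variable {α β R : Type*} {r : α → α → Prop}

open Classical in
/-- The finsets of pairwise unrelated elements of `V`: the independent sets of the graph with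
vertex set `V` and adjacency `r`. -/
def independentSets (r : α → α → Prop) (V : Finset α) : Finset (Finset α) :=
  V.powerset.filter fun D => ∀ a ∈ D, ∀ b ∈ D, a ≠ b → ¬ r a b

/-- The multivariate independence polynomial of the graph with vertex set `V` and adjacency `r`,
evaluated at the vertex weights `w`. -/
def independenceSum [CommSemiring R] (r : α → α → Prop) (w : α → R) (V : Finset α) : R :=
  ∑ D ∈ independentSets r V, ∏ d ∈ D, w d

theorem mem_independentSets {V D : Finset α} :
    D ∈ independentSets r V ↔ D ⊆ V ∧ ∀ a ∈ D, ∀ b ∈ D, a ≠ b → ¬ r a b := by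
  simp only [independentSets, mem_filter, mem_powerset]

section CommSemiring

variable [CommSemiring R] {w w' : α → R} {V W : Finset α}

theorem independenceSum_congr (h : ∀ d ∈ V, w d = w' d) :
    independenceSum r w V = independenceSum r w' V :=
  sum_congr rfl fun _ hD => prod_congr rfl fun d hd => h d ((mem_independentSets.1 hD).1 hd)

@[simp]
theorem independenceSum_empty : independenceSum r w ∅ = 1 := by
  simp [independenceSum, independentSets, filter_singleton]

theorem independenceSum_of_subset (hWV : W ⊆ V) (hw : ∀ d ∈ V, d ∉ W → w d = 0) :
    independenceSum r w V = independenceSum r w W := by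
  refine (sum_subset (fun D hD => ?_) fun D hD hDW => ?_).symm
  · rw [mem_independentSets] at hD ⊢
    exact ⟨hD.1.trans hWV, hD.2⟩
  · rw [mem_independentSets] at hD hDW
    obtain ⟨d, hd, hdW⟩ := not_subset.1 fun h => hDW ⟨h, hD.2⟩
    exact prod_eq_zero hd (hw d (hD.1 hd) hdW)

theorem independentSets_image [DecidableEq β] {s : β → β → Prop} {f : α → β}
    (hf : Set.InjOn f V) (hs : ∀ a ∈ V, ∀ b ∈ V, a ≠ b → (s (f a) (f b) ↔ r a b)) :
    independentSets s (V.image f) = (independentSets r V).image (image f) := by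
  ext E
  simp only [mem_image, mem_independentSets, subset_image_iff]
  constructor
  · rintro ⟨⟨D, hDV, rfl⟩, hD⟩
    simp only [forall_mem_image] at hD
    exact ⟨D, ⟨hDV, fun a ha b hb hab => (hs a (hDV ha) b (hDV hb) hab).not.1
      (hD ha hb (hf.ne (hDV ha) (hDV hb) hab))⟩, rfl⟩
  · rintro ⟨D, ⟨hDV, hD⟩, rfl⟩
    refine ⟨⟨D, hDV, rfl⟩, ?_⟩
    simp only [forall_mem_image]
    intro a ha b hb hab
    have hne : a ≠ b := fun h => hab (congrArg f h)
    exact (hs a (hDV ha) b (hDV hb) hne).not.2 (hD a ha b hb hne)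

theorem independenceSum_image [DecidableEq β] {s : β → β → Prop} {f : α → β} {w : β → R}
    (hf : Set.InjOn f V) (hs : ∀ a ∈ V, ∀ b ∈ V, a ≠ b → (s (f a) (f b) ↔ r a b)) :
    independenceSum s w (V.image f) = independenceSum r (w ∘ f) V := by
  have hsub {D : Finset α} (hD : D ∈ independentSets r V) : D ⊆ V := (mem_independentSets.1 hD).1
  rw [independenceSum, independentSets_image hf hs, sum_image fun D hD E hE h =>
    image_injOn_powerset_of_injOn hf (mem_powerset.2 (hsub hD)) (mem_powerset.2 (hsub hE)) h]
  exact sum_congr rfl fun D hD => prod_image (hf.mono (hsub hD))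

open Classical in
theorem independenceSum_eq_erase_add [DecidableEq α] [Std.Symm r] {c : α} (hc : c ∈ V) :
    independenceSum r w V = independenceSum r w (V.erase c) +
      w c * independenceSum r w {d ∈ V.erase c | ¬ r c d} := by
  have hinsert {D : Finset α} (hD : D ∈ independentSets r {d ∈ V.erase c | ¬ r c d}) : c ∉ D :=
    fun h => notMem_erase c V (mem_filter.1 ((mem_independentSets.1 hD).1 h)).1
  have hsplit : independentSets r V = independentSets r (V.erase c) ∪
      (independentSets r {d ∈ V.erase c | ¬ r c d}).image (insert c) := by
    ext D
    simp only [mem_union, mem_image, mem_independentSets, subset_iff, mem_filter, mem_erase]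
    constructor
    · rintro ⟨hDV, hD⟩
      by_cases hcD : c ∈ D
      · exact Or.inr ⟨D.erase c, by grind, insert_erase hcD⟩
      · exact Or.inl (by grind)
    · rintro (hD | ⟨D, hD, rfl⟩) <;> grind [Std.Symm]
  rw [independenceSum, hsplit, sum_union, sum_image, independenceSum, independenceSum, mul_sum]
  · exact congrArg _ (sum_congr rfl fun D hD => prod_insert (hinsert hD))
  · intro D hD E hE h
    rw [← erase_insert (hinsert hD), h, erase_insert (hinsert hE)]
  · simp only [disjoint_left, mem_image, mem_independentSets]
    grind

open Classical in
theorem independenceSum_union [DecidableEq α] [Std.Symm r] (hVW : Disjoint V W)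
    (h : ∀ a ∈ V, ∀ b ∈ W, ¬ r a b) :
    independenceSum r w (V ∪ W) = independenceSum r w V * independenceSum r w W := by
  induction V using Finset.strongInduction with
  | _ V ih =>
    rcases V.eq_empty_or_nonempty with rfl | ⟨c, hc⟩
    · simp
    have hcW : c ∉ W := disjoint_left.1 hVW hc
    have herase : (V ∪ W).erase c = V.erase c ∪ W := by grind
    have hlink : {d ∈ V.erase c ∪ W | ¬ r c d} = {d ∈ V.erase c | ¬ r c d} ∪ W := by
      grind
    have ih' {U : Finset α} (hU : U ⊆ V.erase c) :
        independenceSum r w (U ∪ W) = independenceSum r w U * independenceSum r w W := by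
      have hUV : U ⊆ V := hU.trans (erase_subset c V)
      exact ih U (hU.trans_ssubset (erase_ssubset hc)) (hVW.mono_left hUV)
        fun a ha => h a (hUV ha)
    rw [independenceSum_eq_erase_add (mem_union_left W hc), herase, hlink, ih' subset_rfl,
      ih' (filter_subset _ _), independenceSum_eq_erase_add hc]
    ring

end CommSemiring

open Classical in
theorem independenceSum_sub_of_eq_off [CommRing R] [DecidableEq α] [Std.Symm r] {w w' : α → R}
    {V : Finset α} {c : α} (hc : c ∈ V) (hw : ∀ d ≠ c, w d = w' d) :
    independenceSum r w V - independenceSum r w' V =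
      (w c - w' c) * independenceSum r w' {d ∈ V.erase c | ¬ r c d} := by
  have hcongr {U : Finset α} (hU : U ⊆ V.erase c) :
      independenceSum r w U = independenceSum r w' U :=
    independenceSum_congr fun d hd => hw d (ne_of_mem_erase (hU hd))
  rw [independenceSum_eq_erase_add hc, independenceSum_eq_erase_add hc,
    hcongr subset_rfl, hcongr (filter_subset _ _)]
  ring

end IndependenceSum

namespace Dissection

open Finset

section LinearOrder

variable {α β R : Type*} [LinearOrder α] [LinearOrder β]

/-- Two chords cross. A chord is encoded by the pair of its endpoints in increasing order, the
points of `α` being arranged on a circle in their given order. -/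
def Cross (d e : α × α) : Prop :=
  (d.1 < e.1 ∧ e.1 < d.2 ∧ d.2 < e.2) ∨ (e.1 < d.1 ∧ d.1 < e.2 ∧ e.2 < d.2)

instance : Std.Symm (Cross (α := α)) := ⟨fun _ _ => Or.symm⟩

/-- The diagonals of the convex polygon with vertex set `A`. -/
def diagonals (A : Finset α) : Finset (α × α) :=
  (A ×ˢ A).filter fun d => (∃ a ∈ A, d.1 < a ∧ a < d.2) ∧ ∃ a ∈ A, a < d.1 ∨ d.2 < a

/-- The vertex set of the part of the polygon `A` between the endpoints of the chord `c`. -/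
def inside (c : α × α) (A : Finset α) : Finset α := A.filter fun a => c.1 ≤ a ∧ a ≤ c.2

/-- The vertex set of the part of the polygon `A` on the other side of the chord `c`. -/
def outside (c : α × α) (A : Finset α) : Finset α := A.filter fun a => a ≤ c.1 ∨ c.2 ≤ a

theorem mem_diagonals {A : Finset α} {d : α × α} : d ∈ diagonals A ↔
    d.1 ∈ A ∧ d.2 ∈ A ∧ (∃ a ∈ A, d.1 < a ∧ a < d.2) ∧ ∃ a ∈ A, a < d.1 ∨ d.2 < a := by
  simp only [diagonals, mem_filter, mem_product, and_assoc]

variable {A : Finset α} {c : α × α}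

theorem mem_diagonals_inside (hc : c ∈ diagonals A) {d : α × α} :
    d ∈ diagonals (inside c A) ↔ d ∈ diagonals A ∧ d ≠ c ∧ c.1 ≤ d.1 ∧ d.2 ≤ c.2 := by
  obtain ⟨p, q⟩ := c
  obtain ⟨a, b⟩ := d
  simp only [mem_diagonals, inside, mem_filter, ne_eq, Prod.mk.injEq] at hc ⊢
  constructor
  · rintro ⟨ha, hb, ⟨s, hs, has, hsb⟩, t, ht, htab⟩
    exact ⟨⟨ha.1, hb.1, ⟨s, hs.1, has, hsb⟩, t, ht.1, htab⟩, by grind, ha.2.1, hb.2.2⟩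
  · rintro ⟨⟨ha, hb, ⟨s, hs, has, hsb⟩, -⟩, hne, hpa, hbq⟩
    refine ⟨⟨ha, by grind⟩, ⟨hb, by grind⟩, ⟨s, ⟨hs, by grind⟩, has, hsb⟩, ?_⟩
    rcases hpa.lt_or_eq with hpa | rfl
    · exact ⟨p, by grind⟩
    · exact ⟨q, by grind⟩

theorem mem_diagonals_outside (hc : c ∈ diagonals A) {d : α × α} :
    d ∈ diagonals (outside c A) ↔
      d ∈ diagonals A ∧ d ≠ c ∧ (d.1 ≤ c.1 ∨ c.2 ≤ d.1) ∧ (d.2 ≤ c.1 ∨ c.2 ≤ d.2) := by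
  obtain ⟨p, q⟩ := c
  obtain ⟨a, b⟩ := d
  simp only [mem_diagonals, outside, mem_filter, ne_eq, Prod.mk.injEq] at hc ⊢
  obtain ⟨hp, hq, -⟩ := hc
  constructor
  · rintro ⟨ha, hb, ⟨s, hs, has, hsb⟩, t, ht, htab⟩
    exact ⟨⟨ha.1, hb.1, ⟨s, hs.1, has, hsb⟩, t, ht.1, htab⟩, by grind, ha.2, hb.2⟩
  · rintro ⟨⟨ha, hb, ⟨s, hs, has, hsb⟩, t, ht, htab⟩, hne, hac, hbc⟩
    refine ⟨⟨ha, hac⟩, ⟨hb, hbc⟩, ?_, ?_⟩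
    · by_cases hpab : a < p ∧ p < b
      · exact ⟨p, by grind⟩
      by_cases hqab : a < q ∧ q < b
      · exact ⟨q, by grind⟩
      · exact ⟨s, by grind⟩
    · by_cases hpab : p < a ∨ b < p
      · exact ⟨p, by grind⟩
      by_cases hqab : q < a ∨ b < q
      · exact ⟨q, by grind⟩
      · exact ⟨t, by grind⟩

theorem diagonals_inside_disjoint_outside (hc : c ∈ diagonals A) :
    Disjoint (diagonals (inside c A)) (diagonals (outside c A)) := by
  refine disjoint_left.2 fun d hd hd' => ?_
  rw [mem_diagonals_inside hc] at hd
  rw [mem_diagonals_outside hc] at hd'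
  obtain ⟨-, -, ⟨s, -, hs⟩, -⟩ := mem_diagonals.1 hd.1
  grind

theorem not_cross_of_mem_inside_outside (hc : c ∈ diagonals A) :
    ∀ d ∈ diagonals (inside c A), ∀ e ∈ diagonals (outside c A), ¬ Cross d e := by
  intro d hd e he
  rw [mem_diagonals_inside hc] at hd
  rw [mem_diagonals_outside hc] at he
  grind [Cross]

open Classical in
theorem diagonals_noncrossing_eq (hc : c ∈ diagonals A) :
    {d ∈ (diagonals A).erase c | ¬ Cross c d} =
      diagonals (inside c A) ∪ diagonals (outside c A) := by
  ext d
  simp only [mem_filter, mem_erase, mem_union, mem_diagonals_inside hc, mem_diagonals_outside hc]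
  constructor
  · rintro ⟨⟨hdc, hd⟩, hcross⟩
    obtain ⟨-, -, ⟨s, -, _⟩, -⟩ := mem_diagonals.1 hd
    grind [Cross]
  · grind [Cross]

theorem card_inside_add_card_outside (hc : c ∈ diagonals A) :
    #(inside c A) + #(outside c A) = #A + 2 := by
  obtain ⟨hp, hq, ⟨s, -, hs⟩, -⟩ := mem_diagonals.1 hc
  have hinter : inside c A ∩ outside c A = {c.1, c.2} := by
    ext a
    simp only [inside, outside, mem_inter, mem_filter, mem_insert, mem_singleton]
    grind
  have hunion : inside c A ∪ outside c A = A := by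
    ext a
    simp only [inside, outside, mem_union, mem_filter]
    grind
  rw [← card_union_add_card_inter, hunion, hinter, card_pair (by grind)]

theorem three_le_card_inside (hc : c ∈ diagonals A) : 3 ≤ #(inside c A) := by
  obtain ⟨hp, hq, ⟨s, hs, hps, hsq⟩, -⟩ := mem_diagonals.1 hc
  rw [← card_eq_three.2 ⟨c.1, s, c.2, hps.ne, (hps.trans hsq).ne, hsq.ne, rfl⟩]
  refine card_le_card fun a ha => ?_
  simp only [mem_insert, mem_singleton] at ha
  rw [inside, mem_filter]
  grind

theorem three_le_card_outside (hc : c ∈ diagonals A) : 3 ≤ #(outside c A) := by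
  obtain ⟨hp, hq, ⟨s, -, hs⟩, t, ht, htc⟩ := mem_diagonals.1 hc
  rw [← card_eq_three.2 ⟨c.1, c.2, t, by grind, by grind, by grind, rfl⟩]
  refine card_le_card fun a ha => ?_
  simp only [mem_insert, mem_singleton] at ha
  rw [outside, mem_filter]
  grind

theorem card_add_three_le (hA : 3 ≤ #A) {D : Finset (α × α)}
    (hD : D ∈ independentSets Cross (diagonals A)) : #D + 3 ≤ #A := by
  induction hn : #A using Nat.strong_induction_on generalizing A D with
  | _ n ih =>
    subst hn
    rcases D.eq_empty_or_nonempty with rfl | ⟨c, hcD⟩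
    · simpa using hA
    obtain ⟨hDA, hcross⟩ := mem_independentSets.1 hD
    have hc := hDA hcD
    have hpart {B : Finset α} (hBA : #B < #A) (hB : 3 ≤ #B) :
        #(D ∩ diagonals B) + 3 ≤ #B :=
      ih #B hBA hB (mem_independentSets.2 ⟨inter_subset_right, fun d hd e he =>
        hcross d (mem_of_mem_inter_left hd) e (mem_of_mem_inter_left he)⟩) rfl
    have hsplit : D.erase c ⊆
        (D ∩ diagonals (inside c A)) ∪ (D ∩ diagonals (outside c A)) := by
      rw [← inter_union_distrib_left, ← diagonals_noncrossing_eq hc]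
      intro d hd
      obtain ⟨hdc, hdD⟩ := mem_erase.1 hd
      simp only [mem_inter, mem_filter, mem_erase]
      exact ⟨hdD, ⟨hdc, hDA hdD⟩, hcross c hcD d hdD hdc.symm⟩
    have hcard := (card_le_card hsplit).trans (card_union_le _ _)
    have hadd := card_inside_add_card_outside hc
    have hinside := three_le_card_inside hc
    have houtside := three_le_card_outside hc
    have hDinside := hpart (by omega) hinside
    have hDoutside := hpart (by omega) houtside
    rw [card_erase_of_mem hcD] at hcard
    omega

/-- The sum over all dissections of the polygon with vertex set `A` of the product of the weights
of the diagonals. -/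
def dissectionSum [CommSemiring R] (w : α × α → R) (A : Finset α) : R :=
  independenceSum Cross w (diagonals A)

theorem dissectionSum_image [CommSemiring R] {φ : α → β} (hφ : StrictMonoOn φ A)
    (w : β × β → R) :
    dissectionSum w (A.image φ) = dissectionSum (w ∘ Prod.map φ φ) A := by
  have hlt {a b : α} (ha : a ∈ A) (hb : b ∈ A) : φ a < φ b ↔ a < b := hφ.lt_iff_lt ha hb
  have hdiag : diagonals (A.image φ) = (diagonals A).image (Prod.map φ φ) := by
    ext ⟨p, q⟩
    simp only [mem_diagonals, mem_image, Prod.exists, Prod.map_apply, Prod.mk.injEq]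
    constructor
    · rintro ⟨⟨a, ha, rfl⟩, ⟨b, hb, rfl⟩, ⟨_, ⟨s, hs, rfl⟩, has, hsb⟩, _, ⟨t, ht, rfl⟩, htab⟩
      rw [hlt ha hs] at has
      rw [hlt hs hb] at hsb
      rw [hlt ht ha, hlt hb ht] at htab
      exact ⟨a, b, ⟨ha, hb, ⟨s, hs, has, hsb⟩, t, ht, htab⟩, rfl, rfl⟩
    · rintro ⟨a, b, ⟨ha, hb, ⟨s, hs, has, hsb⟩, t, ht, htab⟩, rfl, rfl⟩
      rw [← hlt ha hs] at has
      rw [← hlt hs hb] at hsb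
      rw [← hlt ht ha, ← hlt hb ht] at htab
      exact ⟨⟨a, ha, rfl⟩, ⟨b, hb, rfl⟩, ⟨_, ⟨s, hs, rfl⟩, has, hsb⟩, _, ⟨t, ht, rfl⟩, htab⟩
  rw [dissectionSum, hdiag]
  refine independenceSum_image (fun d hd e he h => ?_) fun d hd e he _ => ?_
  all_goals
    obtain ⟨hd1, hd2, -⟩ := mem_diagonals.1 hd
    obtain ⟨he1, he2, -⟩ := mem_diagonals.1 he
  · exact Prod.ext (hφ.injOn hd1 he1 (congrArg Prod.fst h))
      (hφ.injOn hd2 he2 (congrArg Prod.snd h))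
  · simp only [Cross, Prod.map_fst, Prod.map_snd, hlt, hd1, hd2, he1, he2]

theorem dissectionSum_sub_of_eq_off [CommRing R] {w w' : α × α → R} (hc : c ∈ diagonals A)
    (hw : ∀ d ≠ c, w d = w' d) :
    dissectionSum w A - dissectionSum w' A =
      (w c - w' c) * (dissectionSum w' (inside c A) * dissectionSum w' (outside c A)) := by
  rw [dissectionSum, dissectionSum, independenceSum_sub_of_eq_off hc hw,
    diagonals_noncrossing_eq hc, independenceSum_union (diagonals_inside_disjoint_outside hc)
      (not_cross_of_mem_inside_outside hc), dissectionSum, dissectionSum]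

/-- The sum over all dissections of an `(n + 3)`-gon of `u` to the number of diagonals. -/
def polygonSum [CommSemiring R] (u : R) (n : ℕ) : R :=
  dissectionSum (fun _ => u) (univ : Finset (Fin (n + 3)))

theorem dissectionSum_const [CommSemiring R] (u : R) {n : ℕ} (hA : #A = n + 3) :
    dissectionSum (fun _ => u) A = polygonSum u n := by
  conv_lhs => rw [← image_orderEmbOfFin_univ A hA]
  exact dissectionSum_image ((A.orderEmbOfFin hA).strictMono.strictMonoOn _) _

end LinearOrder

section Triangulation

variable {R : Type*}

/-- The weight which is `v` on the chords in `S` and `u` on the other ones. -/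
def twoValued (u v : R) (S : Finset (ℤ × ℤ)) (d : ℤ × ℤ) : R := if d ∈ S then v else u

variable [CommSemiring R]

/-- The vertex set of the convex `(n + 3)`-gon whose first vertex is `a`. -/
def polygon (a : ℤ) (n : ℕ) : Finset ℤ := Icc a (a + n + 2)

/-- A lattice path: at each step the sequence increases by `0` or `1`. -/
def IsLatticePath (x : ℕ → ℤ) : Prop := ∀ i, x i ≤ x (i + 1) ∧ x (i + 1) ≤ x i + 1

/-- For `1 ≤ i ≤ n`, the `i`-th diagonal of the triangulation of `polygon (x 0) n` given by the
lattice path `x`. -/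
def arc (n : ℕ) (x : ℕ → ℤ) (i : ℕ) : ℤ × ℤ := (x i, x i + n + 2 - i)

/-- The diagonals of the triangulation given by the lattice path `x`, without the `s` longest
ones. -/
def arcs (n : ℕ) (x : ℕ → ℤ) (s : ℕ) : Finset (ℤ × ℤ) := (Ioc s n).image (arc n x)

/-- The sum over all dissections of an `(n + 3)`-gon of `v` to the number of diagonals in the
triangulation given by the lattice path `x` times `u` to the number of other diagonals. -/
def triangulationSum (u v : R) (n : ℕ) (x : ℕ → ℤ) : R :=
  dissectionSum (twoValued u v (arcs n x 0)) (polygon (x 0) n)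

theorem mem_diagonals_polygon {a : ℤ} {n : ℕ} {d : ℤ × ℤ} : d ∈ diagonals (polygon a n) ↔
    a ≤ d.1 ∧ d.1 + 2 ≤ d.2 ∧ d.2 ≤ a + n + 2 ∧ (a < d.1 ∨ d.2 < a + n + 2) := by
  simp only [mem_diagonals, polygon, mem_Icc]
  constructor
  · rintro ⟨h1, h2, ⟨c, -, h4⟩, e, h5, h6⟩
    omega
  · rintro ⟨h1, h2, h3, h | h⟩
    · exact ⟨by omega, by omega, ⟨d.1 + 1, by omega⟩, a, by omega⟩
    · exact ⟨by omega, by omega, ⟨d.1 + 1, by omega⟩, a + n + 2, by omega⟩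

theorem card_polygon (a : ℤ) (n : ℕ) : #(polygon a n) = n + 3 := by
  rw [polygon, Int.card_Icc]
  omega

theorem IsLatticePath.natCast : IsLatticePath fun i => (i : ℤ) := fun i => by simp

theorem IsLatticePath.shift {x : ℕ → ℤ} (hx : IsLatticePath x) (s : ℕ) :
    IsLatticePath fun i => x (s + i) := fun i => hx (s + i)

theorem IsLatticePath.le_and_le_add {x : ℕ → ℤ} (hx : IsLatticePath x) {i j : ℕ} (h : i ≤ j) :
    x i ≤ x j ∧ x j ≤ x i + (j - i) := by
  induction j, h using Nat.le_induction with
  | base => simp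
  | succ j _ ih =>
    have := hx j
    omega

theorem mem_arcs {n s : ℕ} {x : ℕ → ℤ} {d : ℤ × ℤ} :
    d ∈ arcs n x s ↔ ∃ i, s < i ∧ i ≤ n ∧ arc n x i = d := by
  simp only [arcs, mem_image, mem_Ioc, and_assoc]

theorem arc_injective (n : ℕ) (x : ℕ → ℤ) : Function.Injective (arc n x) := by
  intro i j h
  simp only [arc, Prod.mk.injEq] at h
  omega

theorem arc_mem_diagonals {n : ℕ} {x : ℕ → ℤ} (hx : IsLatticePath x) {i : ℕ} (h1 : 1 ≤ i)
    (hn : i ≤ n) : arc n x i ∈ diagonals (polygon (x 0) n) := by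
  have := hx.le_and_le_add (Nat.zero_le i)
  rw [mem_diagonals_polygon]
  simp only [arc]
  omega

theorem arcs_eq_arcs_shift (s m : ℕ) (x : ℕ → ℤ) :
    arcs (s + 1 + m) x (s + 1) = arcs m (fun i => x (s + 1 + i)) 0 := by
  rw [arcs, arcs, show Ioc (s + 1) (s + 1 + m) = (Ioc 0 m).image (s + 1 + ·) by
    rw [image_add_left_Ioc, add_zero], image_image]
  refine image_congr fun i _ => ?_
  simp only [Function.comp_apply, arc, Prod.mk.injEq, true_and]
  push_cast
  ring

theorem inside_arc (s m : ℕ) {x : ℕ → ℤ} (hx : IsLatticePath x) :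
    inside (arc (s + 1 + m) x (s + 1)) (polygon (x 0) (s + 1 + m)) = polygon (x (s + 1)) m := by
  have := hx.le_and_le_add (Nat.zero_le (s + 1))
  ext a
  rw [inside, mem_filter, polygon, polygon, mem_Icc, mem_Icc]
  simp only [arc]
  push_cast at this ⊢
  omega

theorem card_outside_arc (s m : ℕ) {x : ℕ → ℤ} (hx : IsLatticePath x) :
    #(outside (arc (s + 1 + m) x (s + 1)) (polygon (x 0) (s + 1 + m))) = s + 3 := by
  have h := card_inside_add_card_outside
    (arc_mem_diagonals hx (Nat.le_add_left 1 s) (Nat.le_add_right (s + 1) m))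
  rw [inside_arc s m hx, card_polygon, card_polygon] at h
  omega

theorem notMem_arcs_of_mem_outside (s m : ℕ) {x : ℕ → ℤ} (hx : IsLatticePath x) {d : ℤ × ℤ}
    (hd : d ∈ diagonals (outside (arc (s + 1 + m) x (s + 1)) (polygon (x 0) (s + 1 + m)))) :
    d ∉ arcs (s + 1 + m) x (s + 1) := by
  intro h
  obtain ⟨i, hi, -, rfl⟩ := mem_arcs.1 h
  have := hx.le_and_le_add hi.le
  rw [mem_diagonals_outside
    (arc_mem_diagonals hx (Nat.le_add_left 1 s) (Nat.le_add_right (s + 1) m))] at hd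
  obtain ⟨hd, -, hd1, hd2⟩ := hd
  rw [mem_diagonals_polygon] at hd
  simp only [arc] at hd hd1 hd2
  omega

theorem triangulationSum_zero (u v : R) (x : ℕ → ℤ) :
    triangulationSum u v 0 x = polygonSum u 0 := by
  rw [triangulationSum, arcs, Ioc_self, image_empty, ← dissectionSum_const u (card_polygon (x 0) 0)]
  exact independenceSum_congr fun d _ => if_neg (notMem_empty d)

theorem polygonSum_zero (u : R) : polygonSum u 0 = 1 := by
  have h : diagonals (polygon 0 0) = ∅ := by
    ext d
    simp only [mem_diagonals_polygon, notMem_empty, iff_false]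
    omega
  rw [← dissectionSum_const u (card_polygon 0 0), dissectionSum, h, independenceSum_empty]

/-- No dissection uses a diagonal through the last vertex when `v = 0`, and the diagonal which
separates this vertex from the others crosses none of the remaining ones. -/
theorem triangulationSum_natCast (u : R) (n : ℕ) :
    triangulationSum u 0 (n + 1) (fun i => (i : ℤ)) = (1 + u) * polygonSum u n := by
  classical
  set c : ℤ × ℤ := (0, n + 2) with hc
  have hcn : c ∉ diagonals (polygon 0 n) := by simp [mem_diagonals_polygon, hc]
  have hmem {d : ℤ × ℤ} (hd : d ∈ diagonals (polygon 0 (n + 1))) :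
      d ∈ arcs (n + 1) (fun i => (i : ℤ)) 0 ↔ d ∉ insert c (diagonals (polygon 0 n)) := by
    simp only [mem_diagonals_polygon, mem_insert, mem_arcs, arc, Prod.ext_iff, hc] at hd ⊢
    push_cast at hd ⊢
    refine ⟨fun ⟨i, _⟩ => by omega, fun _ => ⟨d.1.toNat, by omega⟩⟩
  have hsub : insert c (diagonals (polygon 0 n)) ⊆ diagonals (polygon 0 (n + 1)) := by
    intro d hd
    simp only [mem_diagonals_polygon, mem_insert, Prod.ext_iff, hc] at hd ⊢
    push_cast
    omega
  have hlink : {d ∈ diagonals (polygon 0 n) | ¬ Cross c d} = diagonals (polygon 0 n) := by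
    refine filter_true_of_mem fun d hd => ?_
    simp only [mem_diagonals_polygon, Cross, hc] at hd ⊢
    omega
  calc triangulationSum u 0 (n + 1) (fun i => (i : ℤ))
      = independenceSum Cross (twoValued u 0 (arcs (n + 1) (fun i => (i : ℤ)) 0))
          (insert c (diagonals (polygon 0 n))) :=
        independenceSum_of_subset hsub fun d hd hd' => if_pos ((hmem hd).2 hd')
    _ = independenceSum Cross (fun _ => u) (insert c (diagonals (polygon 0 n))) :=
        independenceSum_congr fun d hd => if_neg fun h => (hmem (hsub hd)).1 h hd
    _ = (1 + u) * polygonSum u n := by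
        rw [independenceSum_eq_erase_add (mem_insert_self _ _), erase_insert hcn, hlink,
          ← dissectionSum, dissectionSum_const u (card_polygon 0 n)]
        ring

end Triangulation

section IsLatticePath

variable {R : Type*} [CommRing R]

theorem dissectionSum_arcs_sub_succ (u v : R) (s m : ℕ) {x : ℕ → ℤ} (hx : IsLatticePath x) :
    dissectionSum (twoValued u v (arcs (s + 1 + m) x s)) (polygon (x 0) (s + 1 + m)) -
      dissectionSum (twoValued u v (arcs (s + 1 + m) x (s + 1))) (polygon (x 0) (s + 1 + m)) =
      (v - u) * (polygonSum u s * triangulationSum u v m fun i => x (s + 1 + i)) := by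
  have hc := arc_mem_diagonals hx (Nat.le_add_left 1 s) (Nat.le_add_right (s + 1) m)
  have hmem : arc (s + 1 + m) x (s + 1) ∈ arcs (s + 1 + m) x s :=
    mem_arcs.2 ⟨s + 1, by omega, by omega, rfl⟩
  have hnotMem : arc (s + 1 + m) x (s + 1) ∉ arcs (s + 1 + m) x (s + 1) := fun h => by
    obtain ⟨i, hi, -, h⟩ := mem_arcs.1 h
    exact hi.ne' (arc_injective _ _ h)
  have harcs : arcs (s + 1 + m) x (s + 1) =
      (arcs (s + 1 + m) x s).erase (arc (s + 1 + m) x (s + 1)) := by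
    rw [arcs, arcs, ← image_erase (arc_injective _ x)]
    congr 1
    ext i
    simp only [mem_erase, mem_Ioc]
    omega
  have hout : dissectionSum (twoValued u v (arcs (s + 1 + m) x (s + 1)))
      (outside (arc (s + 1 + m) x (s + 1)) (polygon (x 0) (s + 1 + m))) = polygonSum u s := by
    rw [← dissectionSum_const u (card_outside_arc s m hx)]
    exact independenceSum_congr fun d hd => if_neg (notMem_arcs_of_mem_outside s m hx hd)
  rw [dissectionSum_sub_of_eq_off hc, hout, inside_arc s m hx, twoValued, twoValued, if_pos hmem,
    if_neg hnotMem, arcs_eq_arcs_shift, triangulationSum, add_zero]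
  · ring
  · intro d hd
    simp only [twoValued, harcs, mem_erase, hd, ne_eq, not_false_eq_true, true_and]

theorem triangulationSum_succ (u v : R) (n : ℕ) {x : ℕ → ℤ} (hx : IsLatticePath x) :
    triangulationSum u v (n + 1) x =
      polygonSum u (n + 1) + (v - u) * ∑ p ∈ antidiagonal n,
        polygonSum u p.1 * triangulationSum u v p.2 fun i => x (p.1 + 1 + i) := by
  have hfull : dissectionSum (twoValued u v (arcs (n + 1) x (n + 1))) (polygon (x 0) (n + 1)) =
      polygonSum u (n + 1) := by
    rw [← dissectionSum_const u (card_polygon (x 0) (n + 1)), arcs, Ioc_self, image_empty]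
    exact independenceSum_congr fun d _ => if_neg (notMem_empty d)
  rw [Nat.sum_antidiagonal_eq_sum_range_succ_mk, mul_sum, ← sub_eq_iff_eq_add', ← hfull,
    triangulationSum, ← sum_range_sub' fun s =>
      dissectionSum (twoValued u v (arcs (n + 1) x s)) (polygon (x 0) (n + 1))]
  refine sum_congr rfl fun s hs => ?_
  obtain ⟨m, rfl⟩ := Nat.exists_eq_add_of_le (mem_range_succ_iff.1 hs)
  rw [show s + m + 1 = s + 1 + m by ring, dissectionSum_arcs_sub_succ u v s m hx,
    Nat.add_sub_cancel_left]

theorem triangulationSum_eq_of_isLatticePath (u v : R) (n : ℕ) {x y : ℕ → ℤ}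
    (hx : IsLatticePath x) (hy : IsLatticePath y) :
    triangulationSum u v n x = triangulationSum u v n y := by
  induction n using Nat.strong_induction_on generalizing x y with
  | _ n ih =>
    cases n with
    | zero => rw [triangulationSum_zero, triangulationSum_zero]
    | succ n =>
      rw [triangulationSum_succ u v n hx, triangulationSum_succ u v n hy]
      congr 2
      refine sum_congr rfl fun p hp => ?_
      have := mem_antidiagonal.1 hp
      rw [ih p.2 (by omega) (hx.shift _) (hy.shift _)]

end IsLatticePath

end Dissection

section Lagrange

open PowerSeries

variable {R : Type*} [CommRing R]

theorem coeff_pow_mul_sub_X_mul_derivative (φ : R⟦X⟧) (n p : ℕ) :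
    (n + 1) * coeff p (φ ^ n * (φ - X * d⁄dX R φ)) = (n + 1 - p) * coeff p (φ ^ (n + 1)) := by
  have hX : coeff p (X * d⁄dX R (φ ^ (n + 1))) = p * coeff p (φ ^ (n + 1)) := by
    cases p with
    | zero => simp
    | succ p => rw [coeff_succ_X_mul, coeff_derivative, Nat.cast_succ, mul_comm]
  have hpow : X * d⁄dX R (φ ^ (n + 1)) = (n + 1) • (φ ^ n * (X * d⁄dX R φ)) := by
    rw [derivative_pow, Nat.add_sub_cancel, nsmul_eq_mul]
    ring
  rw [hpow, map_nsmul, nsmul_eq_mul, Nat.cast_succ] at hX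
  rw [mul_sub, map_sub, mul_sub, hX, ← pow_succ]
  ring

theorem hasSubst_X_mul (φ : R⟦X⟧) : HasSubst (X * φ) :=
  HasSubst.of_constantCoeff_zero' (by rw [map_mul, constantCoeff_X, zero_mul])

variable {φ W : R⟦X⟧}

theorem coeff_mul_subst_of_eq_X_mul_subst [IsAddTorsionFree R] (hW : W = X * φ.subst W) (n : ℕ)
    (H : R⟦X⟧) :
    coeff n ((φ * H).subst W) = coeff n (H * (φ ^ n * (φ - X * d⁄dX R φ))) := by
  have hsubst : HasSubst W := by
    rw [hW]
    exact hasSubst_X_mul _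
  have hshift (h₀ : R) (H₁ : R⟦X⟧) :
      (X * H₁ + C h₀).subst W = X * (φ * H₁).subst W + C h₀ := by
    rw [subst_add hsubst, subst_mul hsubst, subst_mul hsubst, subst_X hsubst, subst_C,
      ← mul_assoc, ← hW]
    rfl
  induction n generalizing H with
  | zero =>
    rw [eq_X_mul_shift_add_const (φ * H), hshift]
    simp [mul_comm]
  | succ n ih =>
    have hconst : coeff (n + 1) (φ ^ n * (φ - X * d⁄dX R φ)) = 0 := by
      have h := coeff_pow_mul_sub_X_mul_derivative φ n (n + 1)
      rw [Nat.cast_succ, sub_self, zero_mul, ← Nat.cast_succ, ← nsmul_eq_mul] at h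
      exact (nsmul_eq_zero_iff_right n.succ_ne_zero).1 h
    obtain ⟨h₀, H₁, hH⟩ : ∃ (h₀ : R) (H₁ : R⟦X⟧), φ * H = X * H₁ + C h₀ :=
      ⟨_, _, eq_X_mul_shift_add_const _⟩
    rw [hH, hshift, map_add, coeff_succ_C, add_zero, coeff_succ_X_mul, ih]
    calc coeff n (H₁ * (φ ^ n * (φ - X * d⁄dX R φ)))
        = coeff (n + 1) ((X * H₁ + C h₀) * (φ ^ n * (φ - X * d⁄dX R φ))) := by
          rw [add_mul, map_add, mul_assoc, coeff_succ_X_mul, coeff_C_mul, hconst, mul_zero,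
            add_zero]
      _ = coeff (n + 1) (H * (φ ^ (n + 1) * (φ - X * d⁄dX R φ))) := by
          rw [← hH]
          ring_nf

end Lagrange

section GammaCoefficients

open Finset PowerSeries

/-- The coefficient of `x ^ k * y ^ l` in the `Γ`-triangle of the cluster complex of type `A_n`.
The division is exact, by `succ_mul_gammaCoeff`. -/
def gammaCoeff (n k l : ℕ) : ℕ :=
  if l + 2 * k ≤ n then (l + 1) * (n + 1).choose k * k.multichoose (n - (l + 2 * k)) / (n + 1)
  else 0

theorem gammaCoeff_of_lt {n k l : ℕ} (h : n < l + 2 * k) : gammaCoeff n k l = 0 :=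
  if_neg h.not_ge

theorem dvd_mul_multichoose (k s : ℕ) : k ∣ s * k.multichoose s := by
  cases k with
  | zero => cases s <;> simp
  | succ k =>
    refine ⟨(k + s).choose (k + 1), ?_⟩
    have h := Nat.choose_succ_right_eq (k + s) k
    rw [Nat.multichoose_eq, Nat.add_right_comm, Nat.add_sub_cancel, ← Nat.choose_symm_add]
    rw [Nat.add_sub_cancel_left] at h
    rw [mul_comm (k + 1), h, mul_comm]

theorem succ_mul_gammaCoeff (k l s : ℕ) :
    (l + 2 * k + s + 1) * gammaCoeff (l + 2 * k + s) k l =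
      (l + 1) * (l + 2 * k + s + 1).choose k * k.multichoose s := by
  rw [gammaCoeff, if_pos (Nat.le_add_right _ s), Nat.add_sub_cancel_left]
  set N := l + 2 * k + s with hN
  refine Nat.mul_div_cancel' ?_
  have hchoose : N + 1 ∣ k * (N + 1).choose k := by
    cases k with
    | zero => simp
    | succ k => exact ⟨N.choose k, by rw [Nat.add_one_mul_choose_eq, mul_comm]⟩
  obtain ⟨r, hr⟩ := dvd_mul_multichoose k s
  refine (Nat.dvd_add_right (hchoose.mul_left (2 * k.multichoose s + r))).1
    ⟨(N + 1).choose k * k.multichoose s, ?_⟩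
  calc (2 * k.multichoose s + r) * (k * (N + 1).choose k) +
        (l + 1) * (N + 1).choose k * k.multichoose s
      = (2 * k * k.multichoose s + k * r + (l + 1) * k.multichoose s) * (N + 1).choose k := by ring
    _ = (N + 1) * ((N + 1).choose k * k.multichoose s) := by rw [← hr, hN]; ring

theorem gammaCoeff_eq {n k l : ℕ} (hk : 1 ≤ k) (h : l + 2 * k ≤ n) :
    (gammaCoeff n k l : ℚ) = ((l : ℚ) + 1) / ((n : ℚ) - (k : ℚ) + 1) * (n.choose k : ℚ) *
      ((n - k - l - 1).choose (k - 1) : ℚ) := by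
  obtain ⟨s, rfl⟩ := Nat.exists_eq_add_of_le h
  have hγ := succ_mul_gammaCoeff k l s
  have hchoose := Nat.choose_mul_succ_eq (l + 2 * k + s) k
  rw [Nat.multichoose_eq] at hγ
  rw [show l + 2 * k + s - k - l - 1 = k + s - 1 by omega,
    Nat.choose_symm_of_eq_add (show k + s - 1 = k - 1 + s by omega)]
  rw [show l + 2 * k + s + 1 - k = l + k + s + 1 by omega] at hchoose
  have hden : ((l + 2 * k + s : ℕ) : ℚ) - k + 1 = l + k + s + 1 := by push_cast; ring
  have hpos : (0 : ℚ) < l + k + s + 1 := by positivity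
  have hpos' : (l : ℚ) + 2 * k + s + 1 ≠ 0 := by positivity
  rw [hden, div_mul_eq_mul_div, div_mul_eq_mul_div, eq_div_iff hpos.ne']
  refine mul_left_cancel₀ hpos' ?_
  qify at hγ hchoose
  linear_combination ((l : ℚ) + k + s + 1) * hγ -
    ((l : ℚ) + 1) * ((k + s - 1).choose s : ℚ) * hchoose

theorem gammaCoeff_zero_self (n : ℕ) : gammaCoeff n 0 n = 1 := by
  simp [gammaCoeff]

theorem gammaCoeff_zero_of_lt {n l : ℕ} (h : l < n) : gammaCoeff n 0 l = 0 := by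
  obtain ⟨s, rfl⟩ := Nat.exists_eq_add_of_lt h
  simp [gammaCoeff, show l + s + 1 - l = s + 1 by omega]

variable {R : Type*} [CommRing R]

/-- The geometric series `1 / (1 - a X)`. -/
def geometricSeries (a : R) : R⟦X⟧ := mk (a ^ ·)

theorem one_sub_C_mul_X_mul_geometricSeries (a : R) :
    (1 - C a * X) * geometricSeries a = 1 := by
  ext (_ | n)
  · simp [geometricSeries]
  · simp [geometricSeries, sub_mul, mul_assoc, coeff_succ_X_mul, pow_succ', coeff_one]

theorem coeff_geometricSeries_pow (a : R) (k s : ℕ) :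
    coeff s (geometricSeries a ^ k) = k.multichoose s * a ^ s := by
  have h : geometricSeries a = rescale a (mk 1) := by
    ext n
    simp [geometricSeries]
  rw [h, ← map_pow, coeff_rescale, mul_comm]
  cases k with
  | zero => cases s <;> simp [coeff_one]
  | succ k =>
    rw [mk_one_pow_eq_mk_choose_add, coeff_mk, Nat.multichoose_eq, Nat.add_right_comm,
      Nat.add_sub_cancel, Nat.choose_symm_add]

/-- The power series `1 + e X² / (1 - b X)`. -/
def kernelSeries (b e : R) : R⟦X⟧ := 1 + C e * (X ^ 2 * geometricSeries b)

theorem coeff_kernelSeries_pow (b e : R) (n p : ℕ) :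
    coeff p (kernelSeries b e ^ n) = ∑ k ∈ range (n + 1), if 2 * k ≤ p then
      n.choose k * k.multichoose (p - 2 * k) * e ^ k * b ^ (p - 2 * k) else 0 := by
  rw [kernelSeries, add_comm, add_pow, map_sum]
  refine sum_congr rfl fun k _ => ?_
  rw [one_pow, mul_one, mul_pow, mul_pow, ← pow_mul, ← map_pow, mul_assoc, mul_assoc,
    coeff_C_mul, coeff_X_pow_mul', ← map_natCast (C (R := R)), coeff_mul_C,
    coeff_geometricSeries_pow]
  split_ifs
  · ring
  · ring

theorem coeff_kernelSeries [IsAddTorsionFree R] (b e : R) (l p : ℕ) :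
    coeff p (kernelSeries b e ^ (l + p) * (kernelSeries b e - X * d⁄dX R (kernelSeries b e))) =
      ∑ k ∈ range (l + p + 1), gammaCoeff (l + p) k l * e ^ k * b ^ (p - 2 * k) := by
  refine nsmul_right_injective (l + p).succ_ne_zero ?_
  have h := coeff_pow_mul_sub_X_mul_derivative (kernelSeries b e) (l + p) p
  simp only [nsmul_eq_mul]
  push_cast at h ⊢
  rw [h, coeff_kernelSeries_pow, sum_range_succ, if_neg (by omega), add_zero, mul_sum, mul_sum]
  refine sum_congr rfl fun k _ => ?_
  split_ifs with hk
  · obtain ⟨s, rfl⟩ := Nat.exists_eq_add_of_le hk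
    have hγ := congrArg (Nat.cast (R := R)) (succ_mul_gammaCoeff k l s)
    rw [Nat.add_sub_cancel_left, ← add_assoc]
    push_cast at hγ ⊢
    linear_combination -(e ^ k * b ^ s) * hγ
  · simp [gammaCoeff_of_lt (show l + p < l + 2 * k by omega)]

end GammaCoefficients

namespace Dissection

section GeneratingFunction

open Finset PowerSeries

variable {R : Type*} [CommRing R]

/-- The generating function of the sums `polygonSum u n`. -/
def polygonSeries (u : R) : R⟦X⟧ := mk (polygonSum u)

/-- The generating function of the sums `triangulationSum u v n x`, which do not depend on the
lattice path `x`. -/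
def triangulationSeries (u v : R) : R⟦X⟧ := mk fun n => triangulationSum u v n fun i => (i : ℤ)

theorem triangulationSeries_eq_add (u v : R) : triangulationSeries u v =
    polygonSeries u + C (v - u) * (X * (polygonSeries u * triangulationSeries u v)) := by
  ext (_ | n)
  · simp [triangulationSeries, polygonSeries, triangulationSum_zero]
  · rw [map_add, coeff_C_mul, coeff_succ_X_mul, coeff_mul, triangulationSeries, coeff_mk,
      triangulationSum_succ u v n .natCast, polygonSeries, coeff_mk]
    congr 2
    refine sum_congr rfl fun p _ => ?_
    rw [coeff_mk, coeff_mk,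
      triangulationSum_eq_of_isLatticePath u v p.2 (IsLatticePath.natCast.shift _) .natCast]

theorem triangulationSeries_zero_right (u : R) :
    triangulationSeries u 0 = 1 + C (1 + u) * (X * polygonSeries u) := by
  ext (_ | n)
  · simp [triangulationSeries, triangulationSum_zero, polygonSum_zero]
  · rw [map_add, coeff_C_mul, coeff_succ_X_mul, coeff_one, if_neg n.succ_ne_zero, zero_add,
      triangulationSeries, coeff_mk, triangulationSum_natCast, polygonSeries, coeff_mk]

theorem polygonSeries_eq (u : R) : polygonSeries u =
    (1 + C (1 + u) * (X * polygonSeries u)) * (1 + C u * (X * polygonSeries u)) := by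
  have h := triangulationSeries_eq_add u 0
  rw [triangulationSeries_zero_right, zero_sub, map_neg] at h
  linear_combination -h

theorem triangulationSeries_mul_one_sub (u v : R) :
    triangulationSeries u v * (1 - C (1 + u + v) * (X * triangulationSeries u (-1 - u))) =
      triangulationSeries u (-1 - u) := by
  have hv := triangulationSeries_eq_add u v
  have h := triangulationSeries_eq_add u (-1 - u)
  generalize triangulationSeries u v = G at *
  generalize triangulationSeries u (-1 - u) = W at *
  simp only [map_add, map_sub, map_one, map_neg] at hv h ⊢
  linear_combination (1 - (1 + 2 * C u) * X * W) * hv - (1 + (C v - C u) * X * G) * h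

theorem X_mul_triangulationSeries_mul_one_sub (u : R) :
    X * triangulationSeries u (-1 - u) *
        (1 - C (1 + 2 * u) * (X * triangulationSeries u (-1 - u))) =
      X * ((1 - C (1 + 2 * u) * (X * triangulationSeries u (-1 - u))) +
        C (u * (1 + u)) * (X * triangulationSeries u (-1 - u)) ^ 2) := by
  have hg := polygonSeries_eq u
  have h := triangulationSeries_eq_add u (-1 - u)
  generalize triangulationSeries u (-1 - u) = W at *
  generalize polygonSeries u = g at *
  have hb : C (1 + 2 * u) = 1 + 2 * C u := by simp [two_mul]
  simp only [hb, map_add, map_sub, map_one, map_neg, map_mul] at hg h ⊢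
  linear_combination X * ((1 - (1 + 2 * C u) * (X * W)) * (1 - X * (1 + 2 * C u)) -
    X ^ 2 * (C u * (1 + C u)) * (g * (1 - (1 + 2 * C u) * (X * W)) + W)) * h +
    X * (1 - (1 + 2 * C u) * (X * W)) ^ 2 * hg

theorem one_sub_mul_subst_geometricSeries (a : R) {W : R⟦X⟧} (hW : HasSubst W) :
    (1 - C a * W) * (geometricSeries a).subst W = 1 := by
  have h := congrArg (subst W) (one_sub_C_mul_X_mul_geometricSeries a)
  rwa [subst_mul hW, subst_sub hW, subst_mul hW, subst_X hW, subst_C, ← map_one (C (R := R)),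
    subst_C] at h

theorem X_mul_triangulationSeries_eq (u : R) : X * triangulationSeries u (-1 - u) =
    X * (kernelSeries (1 + 2 * u) (u * (1 + u))).subst (X * triangulationSeries u (-1 - u)) := by
  have h := X_mul_triangulationSeries_mul_one_sub u
  have hW := hasSubst_X_mul (triangulationSeries u (-1 - u))
  have hgeom := one_sub_mul_subst_geometricSeries (1 + 2 * u) hW
  have hkernel : (kernelSeries (1 + 2 * u) (u * (1 + u))).subst
      (X * triangulationSeries u (-1 - u)) =
      1 + C (u * (1 + u)) * ((X * triangulationSeries u (-1 - u)) ^ 2 *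
        (geometricSeries (1 + 2 * u)).subst (X * triangulationSeries u (-1 - u))) := by
    rw [kernelSeries, subst_add hW, subst_mul hW, subst_mul hW, subst_pow hW, subst_X hW, subst_C,
      ← map_one (C (R := R)), subst_C]
    rfl
  rw [hkernel]
  linear_combination (geometricSeries (1 + 2 * u)).subst (X * triangulationSeries u (-1 - u)) * h +
    (X - X * triangulationSeries u (-1 - u)) * hgeom

theorem triangulationSeries_eq_subst (u v : R) : triangulationSeries u v =
    (kernelSeries (1 + 2 * u) (u * (1 + u)) * geometricSeries (1 + u + v)).subst
      (X * triangulationSeries u (-1 - u)) := by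
  have hgeom := one_sub_mul_subst_geometricSeries (1 + u + v)
    (hasSubst_X_mul (triangulationSeries u (-1 - u)))
  have h := triangulationSeries_mul_one_sub u v
  have hker := X_mul_cancel (X_mul_triangulationSeries_eq u)
  rw [subst_mul (hasSubst_X_mul _), ← hker]
  linear_combination (geometricSeries (1 + u + v)).subst (X * triangulationSeries u (-1 - u)) * h -
    triangulationSeries u v * hgeom

theorem triangulationSum_eq [IsAddTorsionFree R] (u v : R) (n : ℕ) {x : ℕ → ℤ}
    (hx : IsLatticePath x) : triangulationSum u v n x =
      ∑ l ∈ range (n + 1), ∑ k ∈ range (n + 1), gammaCoeff n k l * (u * (1 + u)) ^ k *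
        (1 + 2 * u) ^ (n - l - 2 * k) * (1 + u + v) ^ l := by
  have hcoeff : triangulationSum u v n x = coeff n (triangulationSeries u v) := by
    rw [triangulationSeries, coeff_mk, triangulationSum_eq_of_isLatticePath u v n hx .natCast]
  rw [hcoeff, triangulationSeries_eq_subst,
    coeff_mul_subst_of_eq_X_mul_subst (X_mul_triangulationSeries_eq u), coeff_mul,
    Nat.sum_antidiagonal_eq_sum_range_succ_mk]
  refine sum_congr rfl fun l hl => ?_
  obtain ⟨p, rfl⟩ := Nat.exists_eq_add_of_le (mem_range_succ_iff.1 hl)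
  rw [Nat.add_sub_cancel_left, coeff_kernelSeries, geometricSeries, coeff_mk, mul_comm, sum_mul]

end GeneratingFunction

end Dissection

section GammaTriangle

open Finset

theorem algebraMap_ratXY_injective :
    Function.Injective (algebraMap (MvPolynomial (Fin 2) ℤ) RatXY) :=
  FaithfulSMul.algebraMap_injective _ _

theorem ratX_ne_zero : ratX ≠ 0 := by
  rw [ratX, Ne, FaithfulSMul.algebraMap_eq_zero_iff]
  exact MvPolynomial.X_ne_zero 0

theorem one_sub_ratX_ne_zero : 1 - ratX ≠ 0 := by
  rw [ratX, ← map_one (algebraMap (MvPolynomial (Fin 2) ℤ) RatXY), ← map_sub, Ne,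
    FaithfulSMul.algebraMap_eq_zero_iff]
  intro h
  simpa using congrArg (MvPolynomial.eval 0) h

theorem one_add_ratX_ne_zero : 1 + ratX ≠ 0 := by
  rw [ratX, ← map_one (algebraMap (MvPolynomial (Fin 2) ℤ) RatXY), ← map_add, Ne,
    FaithfulSMul.algebraMap_eq_zero_iff]
  intro h
  simpa using congrArg (MvPolynomial.eval 0) h

theorem isAlgebraic_ratXY {R : Type*} [CommRing R] [IsDomain R] [Algebra R RatXY]
    (hX : IsAlgebraic R ratX) (hY : IsAlgebraic R ratY) : Algebra.IsAlgebraic R RatXY := by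
  have halg (p : MvPolynomial (Fin 2) ℤ) :
      IsAlgebraic R (algebraMap (MvPolynomial (Fin 2) ℤ) RatXY p) := by
    induction p using MvPolynomial.induction_on with
    | C m => simpa using isAlgebraic_intCast m
    | add p q hp hq => rw [map_add]; exact hp.add hq
    | mul_X p i hp =>
      rw [map_mul]
      refine hp.mul ?_
      fin_cases i
      exacts [hX, hY]
  refine ⟨fun a => ?_⟩
  obtain ⟨p, q, -, rfl⟩ := IsFractionRing.div_surjective (A := MvPolynomial (Fin 2) ℤ) a
  rw [div_eq_mul_inv]
  exact (halg p).mul (halg q).inv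

/-- Call `z` and `w` the two elements. As `x` is a root of `x = z (1 + x) ^ 2` and `y` is a rational
function of `x` and `w`, the whole field is algebraic over `ℤ[z, w]`. -/
theorem algebraicIndependent_gammaVariables :
    AlgebraicIndependent ℤ ![ratX / (1 + ratX) ^ 2, (1 + ratX * ratY) / (1 + ratX)] := by
  set z : Fin 2 → RatXY := ![ratX / (1 + ratX) ^ 2, (1 + ratX * ratY) / (1 + ratX)]
  have hx := ratX_ne_zero
  have hx' := one_add_ratX_ne_zero
  let R := Algebra.adjoin ℤ (Set.range z)
  have hmem (i : Fin 2) : z i ∈ R := Algebra.subset_adjoin ⟨i, rfl⟩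
  have hX : IsAlgebraic R ratX := by
    let a : R := ⟨z 0, hmem 0⟩
    refine ⟨.C a * (1 + .X) ^ 2 - .X, fun h => ?_, ?_⟩
    · have ha : a = 0 := by simpa using congrArg (Polynomial.eval 0) h
      exact div_ne_zero hx (pow_ne_zero 2 hx') (congrArg Subtype.val ha)
    · have ha : algebraMap R RatXY a = ratX / (1 + ratX) ^ 2 := rfl
      simp [ha, hx']
  have hY : IsAlgebraic R ratY := by
    have hw : IsAlgebraic R ((1 + ratX * ratY) / (1 + ratX)) :=
      isAlgebraic_algebraMap (⟨z 1, hmem 1⟩ : R)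
    have hy : ratY = ((1 + ratX * ratY) / (1 + ratX) * (1 + ratX) - 1) * ratX⁻¹ := by
      field_simp
      ring
    rw [hy]
    exact ((hw.mul (isAlgebraic_one.add hX)).sub isAlgebraic_one).mul hX.inv
  have := isAlgebraic_ratXY hX hY
  refine (Algebra.IsAlgebraic.isTranscendenceBasis_of_le_trdeg_of_finite ℤ z ?_).1
  calc Cardinal.mk (Fin 2) = Algebra.trdeg ℤ (MvPolynomial (Fin 2) ℤ) := by
        rw [MvPolynomial.trdeg_of_isDomain, Cardinal.lift_id]
    _ ≤ Algebra.trdeg ℤ RatXY :=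
        trdeg_le_of_injective (IsScalarTower.toAlgHom ℤ _ RatXY) algebraMap_ratXY_injective

namespace FinComplex

variable {V : Type*} [DecidableEq V] {C : FinComplex V} {T : Finset V}

theorem aeval_fTriangle {R : Type*} [CommSemiring R] [Algebra ℤ R]
    (h : ∀ F ∈ C.faces, #(F \ T) ≤ #T) (a b : R) :
    MvPolynomial.aeval ![a, b] (C.fTriangle T) =
      ∑ F ∈ C.faces, a ^ #(F \ T) * b ^ #(F ∩ T) := by
  have hmaps : ∀ F ∈ C.faces, (#(F \ T), #(F ∩ T)) ∈ range (#T + 1) ×ˢ range (#T + 1) :=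
    fun F hF => mem_product.2 ⟨mem_range_succ_iff.2 (h F hF),
      mem_range_succ_iff.2 (card_le_card inter_subset_right)⟩
  rw [← sum_fiberwise_of_maps_to hmaps, sum_product, fTriangle, map_sum]
  refine sum_congr rfl fun i _ => ?_
  rw [map_sum]
  refine sum_congr rfl fun j _ => ?_
  simp only [Prod.mk.injEq]
  rw [sum_congr rfl (g := fun _ => a ^ i * b ^ j) fun F hF => by
    rw [(mem_filter.1 hF).2.1, (mem_filter.1 hF).2.2]]
  simp [fNumber, mul_assoc]

/-- The polynomial with coefficients `γ i j` for `i, j ≤ d`. -/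
def gammaPolynomial (d : ℕ) (γ : ℕ → ℕ → ℤ) : MvPolynomial (Fin 2) ℤ :=
  ∑ i ∈ range (d + 1), ∑ j ∈ range (d + 1),
    MvPolynomial.monomial (Finsupp.single 0 i + Finsupp.single 1 j) (γ i j)

theorem aeval_gammaPolynomial {R : Type*} [CommRing R] [Algebra ℤ R] (d : ℕ) (γ : ℕ → ℕ → ℤ)
    (a b : R) :
    MvPolynomial.aeval ![a, b] (gammaPolynomial d γ) =
      ∑ i ∈ range (d + 1), ∑ j ∈ range (d + 1), (γ i j : R) * a ^ i * b ^ j := by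
  simp [gammaPolynomial, MvPolynomial.aeval_monomial, Finsupp.prod_add_index', pow_add, mul_assoc]

theorem coeff_gammaPolynomial {d i j : ℕ} (γ : ℕ → ℕ → ℤ) (hi : i ≤ d) (hj : j ≤ d) :
    (gammaPolynomial d γ).coeff (Finsupp.single 0 i + Finsupp.single 1 j) = γ i j := by
  have hexp (i' j' : ℕ) : (Finsupp.single (0 : Fin 2) i' + Finsupp.single 1 j' =
      Finsupp.single 0 i + Finsupp.single 1 j) ↔ i' = i ∧ j' = j := by
    simp [Finsupp.ext_iff, Fin.forall_fin_two]
  simp [gammaPolynomial, MvPolynomial.coeff_sum, MvPolynomial.coeff_monomial, hexp, ite_and, hi, hj]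

theorem IsGammaTriangle.unique {γ γ' : ℕ → ℕ → ℤ} (h : C.IsGammaTriangle T γ)
    (h' : C.IsGammaTriangle T γ') : γ = γ' := by
  have hpoly : gammaPolynomial #T γ = gammaPolynomial #T γ' := by
    apply algebraicIndependent_gammaVariables
    rw [aeval_gammaPolynomial, aeval_gammaPolynomial]
    exact mul_left_cancel₀ (pow_ne_zero #T one_add_ratX_ne_zero) (h.2.symm.trans h'.2)
  ext i j
  by_cases hij : #T < j + 2 * i
  · rw [h.1 i j hij, h'.1 i j hij]
  · rw [← coeff_gammaPolynomial γ (show i ≤ #T by omega) (show j ≤ #T by omega), hpoly,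
      coeff_gammaPolynomial γ' (by omega) (by omega)]

end FinComplex

end GammaTriangle

namespace TypeA

open Finset Dissection

section CrossVector

variable {n : ℕ}

theorem mem_negSimpleRoots {v : Fin n → ℤ} : v ∈ negSimpleRoots n ↔ ∃ i, v = -simpleRoot i := by
  simp only [negSimpleRoots, mem_image, mem_univ, true_and, eq_comm]

theorem simpleReflection_apply_of_ne {j k : Fin n} (h : j ≠ k) (v : Fin n → ℤ) :
    simpleReflection k v j = v j := by
  simp [simpleReflection, simpleRoot, h]

theorem simpleReflection_apply_self {f : ℕ → ℤ} (hf : f 0 = 0) (hfn : f (n + 1) = 0) (k : Fin n) :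
    simpleReflection k (fun i => f (i + 1)) k = f k - f (k + 1) + f (k + 2) := by
  have hsum : ∑ j : Fin n, f (j + 1) * CartanMatrix.A n j k =
      ∑ i ∈ range (n + 2), ((if i = k + 1 then 2 * f i else 0) - (if i = k then f i else 0) -
        if i = k + 2 then f i else 0) := by
    rw [sum_range_succ, sum_range_succ', ← Fin.sum_univ_eq_sum_range fun i =>
      ((if i + 1 = k + 1 then 2 * f (i + 1) else 0) - (if i + 1 = k then f (i + 1) else 0) -
        if i + 1 = k + 2 then f (i + 1) else 0)]
    simp only [hf, hfn, mul_zero, ite_self, sub_zero, add_zero]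
    refine sum_congr rfl fun j _ => ?_
    simp only [CartanMatrix.A, Matrix.of_apply, Fin.ext_iff]
    split_ifs <;> omega
  have hk := k.2
  rw [simpleReflection, Pi.sub_apply, Pi.smul_apply, simpleRoot, Pi.single_eq_same, smul_eq_mul,
    mul_one, hsum, sum_sub_distrib, sum_sub_distrib, sum_ite_eq', sum_ite_eq', sum_ite_eq']
  simp only [mem_range, show (k : ℕ) + 1 < n + 2 by omega, show (k : ℕ) < n + 2 by omega,
    show (k : ℕ) + 2 < n + 2 by omega, if_true]
  ring

open Classical in
/-- The number of crossings of two chords, with the convention that a chord crosses itself `-1`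
times. -/
def crossNumber (d e : ℤ × ℤ) : ℤ := if d = e then -1 else if Cross d e then 1 else 0

theorem crossNumber_add_crossNumber {d : ℤ × ℤ} {a b : ℤ} (hab : a + 1 < b)
    (h : d ≠ (a, b + 1)) (h' : d ≠ (a + 1, b)) :
    crossNumber d (a, b) + crossNumber d (a + 1, b + 1) =
      crossNumber d (a, b + 1) + crossNumber d (a + 1, b) := by
  simp only [crossNumber, if_neg h, if_neg h']
  simp only [Cross, Prod.ext_iff, ne_eq] at *
  split_ifs <;> omega

/-- The vector of the numbers of crossings of a chord with the diagonals of the triangulation given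
by the lattice path `x`. -/
def crossVector (n : ℕ) (x : ℕ → ℤ) (d : ℤ × ℤ) : Fin n → ℤ :=
  fun i => crossNumber d (arc n x (i + 1))

theorem crossNumber_eq_neg_one_iff {d e : ℤ × ℤ} : crossNumber d e = -1 ↔ d = e := by
  rw [crossNumber]
  split_ifs <;> simp_all

theorem crossNumber_arc_zero {x : ℕ → ℤ} {d : ℤ × ℤ} (hd : d ∈ diagonals (polygon (x 0) n)) :
    crossNumber d (arc n x 0) = 0 := by
  rw [mem_diagonals_polygon] at hd
  simp only [crossNumber, arc, Cross, Prod.ext_iff]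
  split_ifs <;> omega

theorem crossNumber_arc_succ_self {A : Finset ℤ} (x : ℕ → ℤ) {d : ℤ × ℤ} (hd : d ∈ diagonals A) :
    crossNumber d (arc n x (n + 1)) = 0 := by
  obtain ⟨-, -, ⟨s, -, hs⟩, -⟩ := mem_diagonals.1 hd
  simp only [crossNumber, arc, Cross, Prod.ext_iff]
  split_ifs <;> omega

variable {x : ℕ → ℤ} (hx : IsLatticePath x)

include hx

theorem not_cross_arc (i j : ℕ) : ¬ Cross (arc n x i) (arc n x j) := by
  rcases le_total i j with h | h
  all_goals
    have := hx.le_and_le_add h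
    simp only [Cross, arc]
    omega

theorem crossVector_arc (i : Fin n) : crossVector n x (arc n x (i + 1)) = -simpleRoot i := by
  ext j
  rw [crossVector, crossNumber, if_neg (not_cross_arc hx _ _)]
  rcases eq_or_ne j i with rfl | hij
  · simp [simpleRoot]
  · rw [if_neg ((arc_injective n x).ne (by omega)), Pi.neg_apply, simpleRoot,
      Pi.single_eq_of_ne hij, neg_zero]

theorem crossVector_eq_neg_simpleRoot_iff {d : ℤ × ℤ} {i : Fin n} :
    crossVector n x d = -simpleRoot i ↔ d = arc n x (i + 1) := by
  refine ⟨fun h => crossNumber_eq_neg_one_iff.1 ?_, fun h => h ▸ crossVector_arc hx i⟩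
  rw [← crossVector, h, Pi.neg_apply, simpleRoot, Pi.single_eq_same]

theorem simpleReflection_crossVector {y : ℕ → ℤ} (hy : IsLatticePath y) (k : Fin n)
    (hxy : ∀ i ≠ (k : ℕ) + 1, y i = x i) (hk : y (k + 1) = x (k + 1) + 1) {d : ℤ × ℤ}
    (hd : d ∈ diagonals (polygon (x 0) n))
    (hdk : ∀ i ≠ k, d ≠ arc n y (i + 1)) :
    simpleReflection k (crossVector n y d) = crossVector n x d := by
  ext j
  rcases ne_or_eq j k with hjk | rfl
  · rw [simpleReflection_apply_of_ne hjk, crossVector, crossVector, arc, arc, hxy _ (by omega)]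
  have hne {i : ℕ} (hi : i ≠ j + 1) : d ≠ arc n y i := by
    rintro rfl
    rw [mem_diagonals_polygon] at hd
    simp only [arc] at hd
    obtain ⟨i, rfl⟩ : ∃ m, i = m + 1 := Nat.exists_eq_succ_of_ne_zero (by
      rintro rfl
      have := hxy 0 (by omega)
      omega)
    exact hdk ⟨i, by omega⟩ (by grind) rfl
  obtain ⟨hyj, hyj1, hyj2, hxj1⟩ :
      y j = x j ∧ y (j + 1) = x j + 1 ∧ y (j + 2) = x j + 1 ∧ x (j + 1) = x j := by
    have hxstep := hx j
    have hxstep' : _ ≤ x (j + 2) ∧ x (j + 2) ≤ _ := hx (j + 1)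
    have hystep := hy j
    have hystep' : _ ≤ y (j + 2) ∧ y (j + 2) ≤ _ := hy (j + 1)
    rw [hxy j (by omega), hk] at hystep
    rw [hk, hxy (j + 2) (by omega)] at hystep'
    rw [hxy j (by omega), hxy (j + 2) (by omega), hk]
    exact ⟨rfl, by omega, by omega, by omega⟩
  have hj : arc n y j = (x j, x j + n + 1 - j + 1) := by grind [arc]
  have hj1 : arc n y (j + 1) = (x j + 1, x j + n + 1 - j + 1) := by grind [arc]
  have hj2 : arc n y (j + 2) = (x j + 1, x j + n + 1 - j) := by grind [arc]
  have hj1' : arc n x (j + 1) = (x j, x j + n + 1 - j) := by grind [arc]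
  have hflip := crossNumber_add_crossNumber (d := d) (a := x j) (b := x j + n + 1 - j) (by omega)
    (hj ▸ hne (by omega)) (hj2 ▸ hne (by omega))
  rw [← hj, ← hj1, ← hj2, ← hj1'] at hflip
  refine (simpleReflection_apply_self (f := fun i => crossNumber d (arc n y i))
    (crossNumber_arc_zero (by rwa [hxy 0 (by omega)])) (crossNumber_arc_succ_self y hd) j).trans ?_
  rw [crossVector]
  linear_combination -hflip

theorem sigma_crossVector {y : ℕ → ℤ} (hy : IsLatticePath y) (k : Fin n)
    (hxy : ∀ i ≠ (k : ℕ) + 1, y i = x i) (hk : y (k + 1) = x (k + 1) + 1) {d : ℤ × ℤ}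
    (hd : d ∈ diagonals (polygon (x 0) n)) :
    sigma k (crossVector n y d) = crossVector n x d := by
  by_cases hfixed : ∃ i ≠ k, d = arc n y (i + 1)
  · obtain ⟨i, hik, rfl⟩ := hfixed
    have hne : -simpleRoot i ≠ -simpleRoot k :=
      fun h => hik (by simpa [simpleRoot, Pi.single_apply] using congrFun h i)
    rw [crossVector_arc hy, arc, hxy _ (by omega), ← arc, crossVector_arc hx]
    exact if_pos ⟨mem_negSimpleRoots.2 ⟨i, rfl⟩, hne⟩
  · push Not at hfixed
    rw [← simpleReflection_crossVector hx hy k hxy hk hd hfixed]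
    refine if_neg ?_
    rintro ⟨hv, hvk⟩
    obtain ⟨i, hi⟩ := mem_negSimpleRoots.1 hv
    rw [hi] at hvk
    exact hfixed i (fun h => hvk (h ▸ rfl)) ((crossVector_eq_neg_simpleRoot_iff hy).1 hi)

end CrossVector

section Rotation

variable {n : ℕ} {d e : ℤ × ℤ}

/-- The rotation of the chords of the polygon with vertices `0, …, n + 2` which sends each vertex
to the next one. -/
def rot (n : ℕ) (d : ℤ × ℤ) : ℤ × ℤ := if d.2 = n + 2 then (0, d.1 + 1) else (d.1 + 1, d.2 + 1)

theorem mapsTo_rot :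
    Set.MapsTo (rot n) (diagonals (polygon 0 n)) (diagonals (polygon 0 n)) := by
  intro d hd
  rw [mem_coe, mem_diagonals_polygon] at *
  rw [rot]
  split_ifs <;> simp only <;> omega

theorem injOn_rot : Set.InjOn (rot n) (diagonals (polygon 0 n)) := by
  rintro ⟨p, q⟩ hd ⟨p', q'⟩ he h
  rw [mem_coe, mem_diagonals_polygon] at *
  simp only [rot] at *
  rw [Prod.mk.injEq]
  split_ifs at h <;> rw [Prod.mk.injEq] at h <;> omega

theorem cross_rot_iff (hd : d ∈ diagonals (polygon 0 n)) (he : e ∈ diagonals (polygon 0 n)) :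
    Cross (rot n d) (rot n e) ↔ Cross d e := by
  rw [mem_diagonals_polygon] at *
  simp only [rot, Cross]
  split_ifs <;> simp only <;> omega

theorem crossNumber_rot (hd : d ∈ diagonals (polygon 0 n)) (he : e ∈ diagonals (polygon 0 n)) :
    crossNumber (rot n d) (rot n e) = crossNumber d e := by
  classical
  exact if_congr (injOn_rot.eq_iff hd he) rfl (if_congr (cross_rot_iff hd he) rfl rfl)

theorem crossNumber_rot_iterate (hd : d ∈ diagonals (polygon 0 n))
    (he : e ∈ diagonals (polygon 0 n)) (m : ℕ) :
    crossNumber ((rot n)^[m] d) ((rot n)^[m] e) = crossNumber d e := by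
  induction m with
  | zero => rfl
  | succ m ih =>
    rw [Function.iterate_succ_apply', Function.iterate_succ_apply',
      crossNumber_rot (mapsTo_rot.iterate m hd) (mapsTo_rot.iterate m he), ih]

theorem rot_iterate_of_add_le (m : ℕ) {p q : ℤ} (h : q + m ≤ n + 2) :
    (rot n)^[m] (p, q) = (p + m, q + m) := by
  induction m with
  | zero => simp
  | succ m ih =>
    push_cast at h
    rw [Function.iterate_succ_apply', ih (by omega), rot, if_neg (by simp only; omega)]
    push_cast
    simp only [add_assoc]

theorem rot_iterate_to_zero {p q : ℤ} (hq : q ≤ n + 2) :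
    (rot n)^[(n + 2 - q).toNat + 1] (p, q) = (0, p + n + 3 - q) := by
  rw [Function.iterate_succ_apply', rot_iterate_of_add_le _ (by omega), rot,
    if_pos (by simp only; omega), Prod.mk.injEq]
  omega

/-- From `d`, one turn past the last vertex leads to the chord `(0, n + 3 - (d.2 - d.1))`, and a
second one to `(0, d.2 - d.1)`, from which `e` is reached by a translation. -/
theorem exists_rot_iterate_eq (hd : d ∈ diagonals (polygon 0 n))
    (he : e ∈ diagonals (polygon 0 n)) (h : d.2 - d.1 = e.2 - e.1) :
    ∃ m, (rot n)^[m] d = e := by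
  obtain ⟨p, q⟩ := d
  obtain ⟨p', q'⟩ := e
  rw [mem_diagonals_polygon] at *
  simp only at *
  refine ⟨p'.toNat + (((n + 2 - (p + n + 3 - q)).toNat + 1) + ((n + 2 - q).toNat + 1)), ?_⟩
  rw [Function.iterate_add_apply, Function.iterate_add_apply, rot_iterate_to_zero (by omega),
    rot_iterate_to_zero (by omega), rot_iterate_of_add_le _ (by omega), Prod.mk.injEq]
  omega

end Rotation

section CoxeterPath

variable {n : ℕ} (π : Equiv.Perm (Fin n))

/-- The position, counted from `1`, of the letter `i - 1` in the word `π` of a Coxeter element,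
and `0` if there is no such letter. -/
def position (i : ℕ) : ℕ := if h : 1 ≤ i ∧ i ≤ n then π.symm ⟨i - 1, by omega⟩ + 1 else 0

theorem position_succ (i : Fin n) : position π (i + 1) = π.symm i + 1 := by
  rw [position, dif_pos ⟨Nat.le_add_left 1 i, i.2⟩]
  rfl

theorem position_zero : position π 0 = 0 := dif_neg (by omega)

theorem position_le (i : ℕ) : position π i ≤ n := by
  rw [position]
  split_ifs
  · exact Fin.is_lt _
  · exact Nat.zero_le n

theorem position_eq_succ_iff {i : ℕ} {k : Fin n} : position π i = k + 1 ↔ i = π k + 1 := by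
  constructor
  · intro h
    rw [position] at h
    split_ifs at h with hi
    have := (Equiv.symm_apply_eq π).1 (Fin.ext (Nat.succ_injective h))
    rw [← this]
    simp only
    omega
  · rintro rfl
    rw [position_succ, Equiv.symm_apply_apply]

/-- The lattice path of the triangulation attached to a Coxeter element: it goes up from `i` to
`i + 1` when the letter `i` comes after the letter `i - 1`. -/
def coxeterPath (i : ℕ) : ℤ := #{j ∈ range i | position π j < position π (j + 1)}

/-- The lattice path obtained from `coxeterPath π` by lowering the steps whose letter comes after
the first `m` ones. -/
def partialPath (m i : ℕ) : ℤ := coxeterPath π i - if m < position π i then 1 else 0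

theorem coxeterPath_zero : coxeterPath π 0 = 0 := by simp [coxeterPath]

theorem coxeterPath_succ (i : ℕ) : coxeterPath π (i + 1) =
    coxeterPath π i + if position π i < position π (i + 1) then 1 else 0 := by
  rw [coxeterPath, range_add_one, filter_insert, coxeterPath]
  split_ifs <;> simp

theorem isLatticePath_coxeterPath : IsLatticePath (coxeterPath π) := by
  intro i
  rw [coxeterPath_succ]
  split_ifs <;> omega

theorem isLatticePath_partialPath (m : ℕ) : IsLatticePath (partialPath π m) := by
  intro i
  rw [partialPath, partialPath, coxeterPath_succ]
  split_ifs <;> omega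

theorem partialPath_apply_zero (m : ℕ) : partialPath π m 0 = 0 := by
  simp [partialPath, coxeterPath_zero, position_zero]

theorem partialPath_length : partialPath π n = coxeterPath π := by
  ext i
  rw [partialPath, if_neg (position_le π i).not_gt, sub_zero]

theorem partialPath_zero (i : Fin n) : partialPath π 0 (i + 1) = coxeterPath π (i + 1) - 1 := by
  rw [partialPath, position_succ, if_pos (Nat.succ_pos _)]

theorem sigma_partialPath (k : Fin n) {d : ℤ × ℤ} (hd : d ∈ diagonals (polygon 0 n)) :
    sigma (π k) (crossVector n (partialPath π (k + 1)) d) = crossVector n (partialPath π k) d := by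
  refine sigma_crossVector (isLatticePath_partialPath π _) (isLatticePath_partialPath π _) (π k)
    (fun i hi => ?_) ?_ (by rwa [partialPath_apply_zero])
  · have := (position_eq_succ_iff π).not.2 hi
    grind [partialPath]
  · have := (position_eq_succ_iff π (k := k)).2 rfl
    grind [partialPath]

theorem foldr_comp_ofFn_apply {α : Type*} {n : ℕ} {g : Fin n → α → α} {P : ℕ → α}
    (h : ∀ k : Fin n, g k (P (k + 1)) = P k) :
    (List.ofFn g).foldr (· ∘ ·) id (P n) = P 0 := by
  induction n generalizing P with
  | zero => simp
  | succ n ih =>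
    rw [List.ofFn_succ, List.foldr_cons, Function.comp_apply,
      ih (P := fun m => P (m + 1)) fun k => h k.succ]
    exact h 0

theorem tau_crossVector {d : ℤ × ℤ} (hd : d ∈ diagonals (polygon 0 n)) :
    tau π (crossVector n (coxeterPath π) d) = crossVector n (partialPath π 0) d := by
  rw [← partialPath_length π]
  exact foldr_comp_ofFn_apply (P := fun m => crossVector n (partialPath π m) d)
    fun k => sigma_partialPath π k hd

theorem rot_arc_partialPath (i : Fin n) :
    rot n (arc n (partialPath π 0) (i + 1)) = arc n (coxeterPath π) (i + 1) := by
  have := (isLatticePath_coxeterPath π).le_and_le_add (Nat.zero_le (i + 1))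
  rw [coxeterPath_zero] at this
  rw [rot, arc, arc, partialPath_zero, if_neg (by simp only; omega), Prod.mk.injEq]
  omega

/-- The almost positive root of a diagonal of the polygon with vertices `0, …, n + 2`, chosen so
that `tau π` becomes the rotation of the polygon. -/
def rootOf (d : ℤ × ℤ) : Fin n → ℤ := crossVector n (coxeterPath π) d

theorem tau_rootOf {d : ℤ × ℤ} (hd : d ∈ diagonals (polygon 0 n)) :
    tau π (rootOf π d) = rootOf π (rot n d) := by
  rw [rootOf, tau_crossVector π hd]
  ext i
  have harc := arc_mem_diagonals (isLatticePath_partialPath π 0) (Nat.le_add_left 1 i) i.2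
  rw [partialPath_apply_zero] at harc
  rw [rootOf, crossVector, crossVector, ← rot_arc_partialPath, crossNumber_rot hd harc]

theorem tau_iterate_rootOf {d : ℤ × ℤ} (hd : d ∈ diagonals (polygon 0 n)) (m : ℕ) :
    (tau π)^[m] (rootOf π d) = rootOf π ((rot n)^[m] d) := by
  induction m with
  | zero => rfl
  | succ m ih =>
    rw [Function.iterate_succ_apply', Function.iterate_succ_apply', ih,
      tau_rootOf π (mapsTo_rot.iterate m hd)]

theorem exists_rot_iterate_eq_arc {d : ℤ × ℤ} (hd : d ∈ diagonals (polygon 0 n)) :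
    ∃ m, ∃ i : Fin n, (rot n)^[m] d = arc n (coxeterPath π) (i + 1) := by
  have hd' := mem_diagonals_polygon.1 hd
  obtain ⟨i, hi⟩ : ∃ i : Fin n, (i : ℤ) = n + 1 - (d.2 - d.1) :=
    ⟨⟨(n + 1 - (d.2 - d.1)).toNat, by omega⟩, by simp only; omega⟩
  have harc := arc_mem_diagonals (isLatticePath_coxeterPath π) (Nat.le_add_left 1 i) i.2
  rw [coxeterPath_zero] at harc
  obtain ⟨m, hm⟩ := exists_rot_iterate_eq hd harc (by simp only [arc]; push_cast; omega)
  exact ⟨m, i, hm⟩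

theorem rootOf_eq_neg_simpleRoot_iff {d : ℤ × ℤ} {i : Fin n} :
    rootOf π d = -simpleRoot i ↔ d = arc n (coxeterPath π) (i + 1) :=
  crossVector_eq_neg_simpleRoot_iff (isLatticePath_coxeterPath π)

theorem injOn_rootOf : Set.InjOn (rootOf π) (diagonals (polygon 0 n)) := by
  intro d hd e he h
  obtain ⟨m, i, hm⟩ := exists_rot_iterate_eq_arc π hd
  have htau := tau_iterate_rootOf π hd m
  rw [h, tau_iterate_rootOf π he m, (rootOf_eq_neg_simpleRoot_iff π).2 hm,
    rootOf_eq_neg_simpleRoot_iff, ← hm] at htau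
  exact (injOn_rot.iterate mapsTo_rot m he hd htau).symm

theorem crossNumber_nonpos_iff {d e : ℤ × ℤ} : crossNumber d e ≤ 0 ↔ ¬ Cross d e := by
  rw [crossNumber]
  split_ifs with h h' <;> simp_all [Cross]

theorem compatible_rootOf_iff {d e : ℤ × ℤ} (hd : d ∈ diagonals (polygon 0 n))
    (he : e ∈ diagonals (polygon 0 n)) :
    Compatible π (rootOf π d) (rootOf π e) ↔ ¬ Cross d e := by
  have hcoeff (m : ℕ) (i : Fin n) (hm : (rot n)^[m] d = arc n (coxeterPath π) (i + 1)) :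
      rootOf π ((rot n)^[m] e) i ≤ 0 ↔ ¬ Cross d e := by
    rw [rootOf, crossVector, ← hm, crossNumber_rot_iterate he hd, crossNumber_nonpos_iff,
      comm_of Cross]
  simp only [Compatible, tau_iterate_rootOf π hd, tau_iterate_rootOf π he,
    rootOf_eq_neg_simpleRoot_iff]
  constructor
  · rintro ⟨m, i, hm, hi⟩
    exact (hcoeff m i hm).1 hi
  · intro h
    obtain ⟨m, i, hm⟩ := exists_rot_iterate_eq_arc π hd
    exact ⟨m, i, hm, (hcoeff m i hm).2 h⟩

end CoxeterPath

section AlmostPositiveRoots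

variable {n : ℕ}

theorem sum_simpleRoot_apply (i j k : Fin n) :
    (∑ m ∈ Icc i j, simpleRoot m) k = if i ≤ k ∧ k ≤ j then 1 else 0 := by
  simp only [Finset.sum_apply, simpleRoot, sum_pi_single, mem_Icc]

theorem card_negSimpleRoots (n : ℕ) : #(negSimpleRoots n) = n := by
  rw [negSimpleRoots, card_image_of_injective, card_univ, Fintype.card_fin]
  exact neg_injective.comp fun i j h => by
    simpa [simpleRoot, Pi.single_apply] using congrFun h i

theorem sum_simpleRoot_mem_positiveRoots {i j : Fin n} (h : i ≤ j) :
    ∑ m ∈ Icc i j, simpleRoot m ∈ positiveRoots n :=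
  mem_image.2 ⟨(i, j), mem_filter.2 ⟨mem_univ _, h⟩, rfl⟩

theorem eq_arc_or_exists_cross {x : ℕ → ℤ} (hx : IsLatticePath x) {d : ℤ × ℤ}
    (hd : d ∈ diagonals (polygon (x 0) n)) :
    ∃ i : Fin n, d = arc n x (i + 1) ∨ Cross d (arc n x (i + 1)) := by
  by_contra! h
  have hmem : d ∉ arcs n x 0 := fun hmem => by
    obtain ⟨i, hi, hin, rfl⟩ := mem_arcs.1 hmem
    exact (h ⟨i - 1, by omega⟩).1 (by simp only [Nat.sub_add_cancel hi])
  have hind : insert d (arcs n x 0) ∈ independentSets Cross (diagonals (polygon (x 0) n)) := by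
    have hcross {e : ℤ × ℤ} (he : e ∈ arcs n x 0) : ¬ Cross d e := by
      obtain ⟨i, hi, hin, rfl⟩ := mem_arcs.1 he
      simpa only [Nat.sub_add_cancel hi] using (h ⟨i - 1, by omega⟩).2
    rw [mem_independentSets, insert_subset_iff]
    refine ⟨⟨hd, fun e he => ?_⟩, fun e he f hf hef => ?_⟩
    · obtain ⟨i, hi, hin, rfl⟩ := mem_arcs.1 he
      exact arc_mem_diagonals hx hi hin
    · rcases mem_insert.1 he with rfl | he' <;> rcases mem_insert.1 hf with rfl | hf'
      · exact absurd rfl hef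
      · exact hcross hf'
      · exact fun h => hcross he' (symm h)
      · obtain ⟨i, -, -, rfl⟩ := mem_arcs.1 he'
        obtain ⟨j, -, -, rfl⟩ := mem_arcs.1 hf'
        exact not_cross_arc hx i j
  have hcard := card_add_three_le (by rw [card_polygon]; omega) hind
  rw [card_insert_of_notMem hmem, card_polygon, arcs, card_image_of_injective _ (arc_injective n x),
    Nat.card_Ioc] at hcard
  omega

/-- The diagonals of the triangulation crossed by a chord are consecutive. -/
theorem crossVector_mem_almostPositiveRoots {x : ℕ → ℤ} (hx : IsLatticePath x) {d : ℤ × ℤ}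
    (hd : d ∈ diagonals (polygon (x 0) n)) :
    crossVector n x d ∈ almostPositiveRoots n := by
  classical
  by_cases harc : ∃ i : Fin n, d = arc n x (i + 1)
  · obtain ⟨i, rfl⟩ := harc
    rw [crossVector_arc hx]
    exact mem_union_left _ (mem_negSimpleRoots.2 ⟨i, rfl⟩)
  push Not at harc
  have hcross : ({i | Cross d (arc n x (i + 1))} : Finset (Fin n)).Nonempty := by
    obtain ⟨i, hi⟩ := eq_arc_or_exists_cross hx hd
    exact ⟨i, mem_filter.2 ⟨mem_univ i, hi.resolve_left (harc i)⟩⟩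
  set S : Finset (Fin n) := {i | Cross d (arc n x (i + 1))}
  have hS {k : Fin n} (hmin : S.min' hcross ≤ k) (hmax : k ≤ S.max' hcross) :
      Cross d (arc n x (k + 1)) := by
    have h := (mem_filter.1 (S.min'_mem hcross)).2
    have h' := (mem_filter.1 (S.max'_mem hcross)).2
    have hle := hx.le_and_le_add (Nat.add_le_add_right (Fin.le_def.1 hmin) 1)
    have hle' := hx.le_and_le_add (Nat.add_le_add_right (Fin.le_def.1 hmax) 1)
    simp only [Cross, arc] at *
    omega
  have hsum : crossVector n x d = ∑ m ∈ Icc (S.min' hcross) (S.max' hcross), simpleRoot m := by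
    ext k
    rw [sum_simpleRoot_apply, crossVector, crossNumber, if_neg (harc k)]
    refine if_congr ⟨fun h => ?_, fun h => hS h.1 h.2⟩ rfl rfl
    have hk : k ∈ S := mem_filter.2 ⟨mem_univ k, h⟩
    exact ⟨S.min'_le k hk, S.le_max' k hk⟩
  rw [hsum]
  exact mem_union_right _ (sum_simpleRoot_mem_positiveRoots (S.min'_le_max' hcross))

theorem almostPositiveRoots_subset_image_crossVector (n : ℕ) :
    almostPositiveRoots n ⊆
      (diagonals (polygon 0 n)).image (crossVector n fun i => (i : ℤ)) := by
  refine union_subset (fun v hv => ?_) (fun v hv => ?_)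
  · obtain ⟨i, rfl⟩ := mem_negSimpleRoots.1 hv
    exact mem_image.2 ⟨_, arc_mem_diagonals IsLatticePath.natCast (Nat.le_add_left 1 i) i.2,
      crossVector_arc IsLatticePath.natCast i⟩
  · obtain ⟨⟨i, j⟩, hij, rfl⟩ := mem_image.1 hv
    have hij : i ≤ j := (mem_filter.1 hij).2
    rw [Fin.le_def] at hij
    refine mem_image.2 ⟨((i : ℤ), (j : ℤ) + 2), ?_, ?_⟩
    · rw [mem_diagonals_polygon]
      simp only
      omega
    · ext k
      rw [sum_simpleRoot_apply, crossVector, crossNumber]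
      simp only [arc, Cross, Prod.mk.injEq, Fin.le_def]
      split_ifs <;> omega

variable (π : Equiv.Perm (Fin n))

theorem rootOf_mem_almostPositiveRoots {d : ℤ × ℤ} (hd : d ∈ diagonals (polygon 0 n)) :
    rootOf π d ∈ almostPositiveRoots n :=
  crossVector_mem_almostPositiveRoots (isLatticePath_coxeterPath π)
    (by rwa [coxeterPath_zero])

theorem image_rootOf : (diagonals (polygon 0 n)).image (rootOf π) = almostPositiveRoots n := by
  refine eq_of_subset_of_card_le (image_subset_iff.2 fun d => rootOf_mem_almostPositiveRoots π) ?_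
  rw [card_image_of_injOn (injOn_rootOf π)]
  exact (card_le_card (almostPositiveRoots_subset_image_crossVector n)).trans card_image_le

theorem rootOf_mem_negSimpleRoots_iff {d : ℤ × ℤ} :
    rootOf π d ∈ negSimpleRoots n ↔ d ∈ arcs n (coxeterPath π) 0 := by
  simp only [mem_negSimpleRoots, rootOf_eq_neg_simpleRoot_iff, mem_arcs]
  constructor
  · rintro ⟨i, rfl⟩
    exact ⟨i + 1, Nat.succ_pos _, i.2, rfl⟩
  · rintro ⟨i, hi, hin, rfl⟩
    exact ⟨⟨i - 1, by omega⟩, by simp only [Nat.sub_add_cancel hi]⟩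

theorem faces_clusterComplex : (clusterComplex π).faces =
    independentSets (fun α β => ¬ Compatible π α β) (almostPositiveRoots n) := by
  ext F
  simp only [clusterComplex, mem_filter, mem_powerset, mem_independentSets, not_not]

theorem card_le_of_mem_faces_clusterComplex {F : Finset (Fin n → ℤ)}
    (hF : F ∈ (clusterComplex π).faces) : #F ≤ n := by
  rw [faces_clusterComplex, ← image_rootOf π, independentSets_image (injOn_rootOf π)
    fun d hd e he _ => (compatible_rootOf_iff π hd he).not_left] at hF
  obtain ⟨D, hD, rfl⟩ := mem_image.1 hF
  have hcard := card_add_three_le (by rw [card_polygon]; omega) hD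
  rw [card_polygon] at hcard
  exact card_image_le.trans (by omega)

theorem sum_faces_clusterComplex {R : Type*} [CommSemiring R] (a b : R) :
    ∑ F ∈ (clusterComplex π).faces, a ^ #(F \ negSimpleRoots n) * b ^ #(F ∩ negSimpleRoots n) =
      triangulationSum a b n (coxeterPath π) := by
  set w : (Fin n → ℤ) → R := fun v => if v ∈ negSimpleRoots n then b else a
  have hw (F : Finset (Fin n → ℤ)) :
      a ^ #(F \ negSimpleRoots n) * b ^ #(F ∩ negSimpleRoots n) = ∏ v ∈ F, w v := by
    rw [prod_ite, prod_const, prod_const, filter_mem_eq_inter, filter_notMem_eq_sdiff, mul_comm]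
  simp only [hw]
  rw [faces_clusterComplex, ← independenceSum, ← image_rootOf π,
    independenceSum_image (injOn_rootOf π)
      fun d hd e he _ => (compatible_rootOf_iff π hd he).not_left,
    triangulationSum, coxeterPath_zero]
  refine independenceSum_congr fun d _ => ?_
  simp only [w, Function.comp_apply, rootOf_mem_negSimpleRoots_iff, twoValued]

end AlmostPositiveRoots

section GammaTriangle

variable {n : ℕ} (π : Equiv.Perm (Fin n))

theorem hTriangle_clusterComplex : (clusterComplex π).hTriangle (negSimpleRoots n) =
    (1 - ratX) ^ n * triangulationSum (ratX / (1 - ratX)) (ratX * ratY / (1 - ratX)) n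
      (coxeterPath π) := by
  rw [FinComplex.hTriangle, card_negSimpleRoots, FinComplex.aeval_fTriangle fun F hF => ?_,
    sum_faces_clusterComplex]
  rw [card_negSimpleRoots]
  exact (card_le_card sdiff_subset).trans (card_le_of_mem_faces_clusterComplex π hF)

theorem isGammaTriangle_gammaCoeff :
    (clusterComplex π).IsGammaTriangle (negSimpleRoots n) fun k l => gammaCoeff n k l := by
  have hx := one_sub_ratX_ne_zero
  have hx' := one_add_ratX_ne_zero
  have hu : ratX / (1 - ratX) * (1 + ratX / (1 - ratX)) = ratX / (1 - ratX) ^ 2 := by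
    field_simp; ring
  have hu' : 1 + 2 * (ratX / (1 - ratX)) = (1 + ratX) / (1 - ratX) := by field_simp; ring
  have huv : 1 + ratX / (1 - ratX) + ratX * ratY / (1 - ratX) =
      (1 + ratX * ratY) / (1 - ratX) := by
    field_simp; ring
  rw [FinComplex.IsGammaTriangle, hTriangle_clusterComplex, card_negSimpleRoots,
    triangulationSum_eq _ _ n (isLatticePath_coxeterPath π), hu, hu', huv, sum_comm]
  simp only [mul_sum]
  refine ⟨fun k l h => by rw [gammaCoeff_of_lt h, Nat.cast_zero],
    sum_congr rfl fun k _ => sum_congr rfl fun l _ => ?_⟩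
  obtain h | h := lt_or_ge n (l + 2 * k)
  · simp [gammaCoeff_of_lt h]
  obtain ⟨s, rfl⟩ := Nat.exists_eq_add_of_le h
  rw [show l + 2 * k + s - l - 2 * k = s by omega, Int.cast_natCast]
  simp only [div_pow, pow_add, pow_mul]
  field_simp

end GammaTriangle

end TypeA

end

theorem mainTheorem2 (n : ℕ) (π : Equiv.Perm (Fin n)) :
    (∃! γ : ℕ → ℕ → ℤ,
      (TypeA.clusterComplex π).IsGammaTriangle (TypeA.negSimpleRoots n) γ) ∧
    ∀ γ : ℕ → ℕ → ℤ,
      (TypeA.clusterComplex π).IsGammaTriangle (TypeA.negSimpleRoots n) γ →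
      (∀ k ℓ : ℕ, 1 ≤ k → ℓ + 2 * k ≤ n →
        (γ k ℓ : ℚ) = ((ℓ : ℚ) + 1) / ((n : ℚ) - (k : ℚ) + 1) * (n.choose k : ℚ) *
          ((n - k - ℓ - 1).choose (k - 1) : ℚ)) ∧
      γ 0 n = 1 ∧
      (∀ ℓ : ℕ, ℓ < n → γ 0 ℓ = 0) := by
  have hγ := TypeA.isGammaTriangle_gammaCoeff π
  refine ⟨⟨_, hγ, fun γ h => h.unique hγ⟩, fun γ h => ?_⟩
  rw [h.unique hγ]
  exact ⟨fun k l hk hkl => by exact_mod_cast gammaCoeff_eq hk hkl,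
    congrArg Nat.cast (gammaCoeff_zero_self n),
    fun l hl => congrArg Nat.cast (gammaCoeff_zero_of_lt hl)⟩
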